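/- An odd continued fraction is a finite or infinite expression $$\left[1;\frac{\varepsilon_1}{a_1},\frac{\varepsilon_2}{a_2},\dots\right]=1+\cfrac{\varepsilon_1}{a_1+\cfrac{\varepsilon_2}{a_2+\cdots}}$$ of length $0\le l\le\infty$, where all $a_i$ are odd positive integers, $\varepsilon_i=\pm1$, $\varepsilon_1=-1$, $a_j+\varepsilon_{j+1}\ge 2$ for all $j\ge1$ with $j+1\le l$, and, if $2\le l<\infty$ and $a_l=1$, then $\varepsilon_l=1$. (In particular $1=[1;]$ with $l=0$ and $0=[1;\frac{-1}{1}]$ with $l=1$.) An infinite one represents $x$ if its convergents converge to $x$. For rational $x\in[0,1]$ with the finite odd continued fraction $[1;\frac{\varepsilon_1}{a_1},\dots,\frac{\varepsilon_l}{a_l}]$ put $S(x)=a_1+\dots+a_l$, and let $\mathcal M_n=\{x\in\mathbb Q\cap[0,1]: S(x)\le n+1\}$. **Theorem 1.** The equation $\lambda^3-\lambda^2-\lambda-1=0$ has a unique real root $\lambda$. The sets $\mathcal M_n$ are finite and nonempty, and the limit distribution function $$F(x)=\lim_{n\to\infty}\frac{\#\{\xi\in\mathcal M_n:\xi\le x\}}{\#\mathcal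 M_n}$$ exists for every $x\in[0,1]$. Every $x\in[0,1]$ is represented by an odd continued fraction, and whenever $x=[1;\frac{\varepsilon_1}{a_1},\frac{\varepsilon_2}{a_2},\dots]$ is such a representation, of length $l\le\infty$, $$F(x)=1-\sum_{1\le i\le l}\frac{E_i}{\lambda^{A_i}},\qquad E_i=\prod_{j=1}^{i}(-\varepsilon_j),\qquad A_i=\sum_{j=1}^{i}a_j-1,$$ where the series converges absolutely. If $x$ is rational, then $l<\infty$ and the sum is finite. -/

import Mathlib

open Filter Topology

/-- An odd continued fraction `[1; ε₁/a₁, ε₂/a₂, …]` of finite or infinite length `len`.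
Only the entries with index `1 ≤ j ≤ len` are meaningful. -/
structure OddContFrac where
  /-- The number of partial quotients after the initial `1`. -/
  len : ℕ∞
  /-- The partial numerators. -/
  ε : ℕ → ℤ
  /-- The partial quotients. -/
  a : ℕ → ℕ
  ε_sign : ∀ j : ℕ, 1 ≤ j → (j : ℕ∞) ≤ len → ε j = 1 ∨ ε j = -1
  ε_first : 1 ≤ len → ε 1 = -1
  a_odd : ∀ j : ℕ, 1 ≤ j → (j : ℕ∞) ≤ len → Odd (a j)
  admissible : ∀ j : ℕ, 1 ≤ j → ((j + 1 : ℕ) : ℕ∞) ≤ len → 2 ≤ (a j : ℤ) + ε (j + 1)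
  /- If the last partial quotient is `1`, then its sign is `+1`; the fraction `0 = [1; -1/1]`
  of length one is not concerned, because its only sign is forced. -/
  last_quotient : ∀ l : ℕ, len = l → 2 ≤ l → a l = 1 → ε l = 1

namespace OddContFrac

/-- `c.block j k` is `ε_j / (a_j + ε_{j+1} / (a_{j+1} + … + ε_{j+k-1} / a_{j+k-1}))`,
the continued fraction with `k` levels that starts at index `j`. -/
noncomputable def block (c : OddContFrac) : ℕ → ℕ → ℝ
  | _, 0 => 0
  | j, k + 1 => (c.ε j : ℝ) / ((c.a j : ℝ) + block c (j + 1) k)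

/-- The convergent `[1; ε₁/a₁, …, ε_k/a_k]`. -/
noncomputable def convergent (c : OddContFrac) (k : ℕ) : ℝ := 1 + c.block 1 k

/-- `x` is the value of `c`: the last convergent if `c` is finite, the limit of the
convergents if `c` is infinite. -/
def Represents (c : OddContFrac) (x : ℝ) : Prop :=
  (∀ l : ℕ, c.len = l → c.convergent l = x) ∧
    (c.len = ⊤ → Tendsto c.convergent atTop (𝓝 x))

/-- `a₁ + … + a_i`. -/
def quotientSum (c : OddContFrac) (i : ℕ) : ℕ := ∑ j ∈ Finset.Icc 1 i, c.a j

/-- `E_i = ∏_{j ≤ i} (-ε_j)`. -/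
def E (c : OddContFrac) (i : ℕ) : ℤ := ∏ j ∈ Finset.Icc 1 i, -c.ε j

/-- `A_i = a₁ + … + a_i - 1`. -/
def A (c : OddContFrac) (i : ℕ) : ℤ := (c.quotientSum i : ℤ) - 1

/-- The `i`-th summand `E_i / lam ^ A_i`, for `1 ≤ i ≤ len`; there are no other summands. -/
noncomputable def term (c : OddContFrac) (lam : ℝ) (i : ℕ) : ℝ :=
  open Classical in if 1 ≤ i ∧ (i : ℕ∞) ≤ c.len then (c.E i : ℝ) / lam ^ c.A i else 0

end OddContFrac

/-- `S(x) = s`: the number `x` has a finite odd continued fraction with sum of partial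
quotients `s`. -/
def HasQuotientSum (x : ℝ) (s : ℕ) : Prop :=
  ∃ (c : OddContFrac) (l : ℕ), c.len = l ∧ c.Represents x ∧ c.quotientSum l = s

/-- The rationals in `[0, 1]` with `S(x) ≤ n + 1`. -/
def boundedSumSet (n : ℕ) : Set ℝ :=
  {x | x ∈ Set.range ((↑) : ℚ → ℝ) ∧ x ∈ Set.Icc (0 : ℝ) 1 ∧ ∃ s, HasQuotientSum x s ∧ s ≤ n + 1}

/-- The distribution function `#{ξ ∈ M : ξ ≤ x} / #M` of a finite set `M`. -/
noncomputable def empiricalDistribution (M : Set ℝ) (x : ℝ) : ℝ :=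
  ({ξ | ξ ∈ M ∧ ξ ≤ x}.ncard : ℝ) / (M.ncard : ℝ)

/-- `F` is the limit distribution function on `[0, 1]` of the sequence `M` of finite nonempty
subsets of `[0, 1]`. -/
def IsLimitDistribution (M : ℕ → Set ℝ) (F : Set.Icc (0 : ℝ) 1 → ℝ) : Prop :=
  (∀ n, (M n).Finite ∧ (M n).Nonempty ∧ M n ⊆ Set.Icc (0 : ℝ) 1) ∧
    ∀ x : Set.Icc (0 : ℝ) 1,
      Tendsto (fun n => empiricalDistribution (M n) x) atTop (𝓝 (F x))

/-! ### The tribonacci constant -/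

/-! Write `x = 1 - y`, where `y = 1 / (a₁ + ε₂ / (a₂ + …))` lies in `[0, 1]`, and let `T_m` be the
set of such finite tails with quotient sum at most `m`. The proof rests on a self-similarity of the
sets `T_m`. The maps `y ↦ y / (1 + 2y)`, `y ↦ 1 / (3 - y)` and `y ↦ 1 / (1 + y)` raise the first
quotient by 2, prepend 3 with a minus sign and prepend 1 with a plus sign. They carry `T_m`, `T_m ∩
(0, 1)` and `T_m` bijectively onto the parts of `T_{m+2}`, `T_{m+3}` and `T_{m+1}` in `[0, 1/3]`,
`(1/3, 1/2)` and `[1/2, 1]`.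

Counting the parts shows that `#T_m - 1` satisfies the tribonacci recurrence for `m ≥ 1`
(`tailCard_recurrence`). The other two characteristic roots have modulus below 1, so `#T_m /
#T_{m+p}` tends to `lam⁻¹ ^ p` (`tendsto_tailCard_div_add`).

Since the maps are monotone, an asymptotic proportion `d` of tails below `y` determines the one
below each image. For one whole level, `1 / (a + σ y)` receives `lam⁻¹ ^ a * (lam - σ d)`
(`NearDistribution.inv_odd_add_sign_mul`). Iterating this affine rule down the expansion produces
the series. A finite expansion starts from the exact proportion 0 below the tail 0. An infinite one
starts at depth `k` from the trivial estimate 0 with error 1, which shrinks to `lam⁻¹ ^ (a₁ + … +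
a_k)`.

The limit is computed from an arbitrary representation of `x`, so uniqueness of limits makes the
value independent of it. Representations exist by a floor algorithm that selects odd quotients. -/

theorem one_lt_of_tribonacci {lam : ℝ} (h : lam ^ 3 - lam ^ 2 - lam - 1 = 0) : 1 < lam := by
  have h0 : 0 < lam := by
    by_contra hn
    push Not at hn
    nlinarith [sq_nonneg lam, mul_nonneg (neg_nonneg.2 hn) (sq_nonneg lam), sq_nonneg (lam + 1 / 2)]
  by_contra hn
  push Not at hn
  nlinarith [mul_nonneg (sub_nonneg.2 hn) (sq_nonneg lam)]

theorem existsUnique_tribonacci : ∃! lam : ℝ, lam ^ 3 - lam ^ 2 - lam - 1 = 0 := by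
  have hc : ContinuousOn (fun x : ℝ => x ^ 3 - x ^ 2 - x - 1) (Set.Icc 1 2) := by fun_prop
  obtain ⟨x, -, hx⟩ := intermediate_value_Icc (by norm_num : (1 : ℝ) ≤ 2) hc
    (show (0 : ℝ) ∈ Set.Icc _ _ by norm_num)
  refine ⟨x, hx, fun y hy => ?_⟩
  have hx' : x ^ 3 - x ^ 2 - x - 1 = 0 := hx
  have hy' : y ^ 3 - y ^ 2 - y - 1 = 0 := hy
  have h1 := one_lt_of_tribonacci hx'
  have h2 := one_lt_of_tribonacci hy'
  -- The second factor of the difference of the two cubics is positive when both roots exceed 1.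
  have h3 : (y - x) * (y ^ 2 + x * y + x ^ 2 - y - x - 1) = 0 := by linear_combination hy' - hx'
  rcases mul_eq_zero.1 h3 with h | h
  · linarith
  · nlinarith

/-! ### Tails with a given sum of partial quotients -/

/-- `TailSum y s`: the number `y` is `1 / (a₁ + ε₂ / (a₂ + …))` for a finite odd continued
fraction with `a₁ + a₂ + … = s`. -/
inductive TailSum : ℝ → ℕ → Prop
  | zero : TailSum 0 0
  | inv_one_add {y : ℝ} {s : ℕ} : TailSum y s → TailSum (1 / (1 + y)) (s + 1)
  | inv_two_add_inv {y : ℝ} {s : ℕ} : TailSum y s → y ≠ 0 → TailSum (y / (1 + 2 * y)) (s + 2)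
  | inv_three_sub {y : ℝ} {s : ℕ} :
      TailSum y s → 0 < y → y < 1 → TailSum (1 / (3 - y)) (s + 3)

/-- This and the next two ranges are pairwise disjoint, so the position of a nonzero tail determines
which constructor of `TailSum` produced it. -/
theorem inv_one_add_mem {y : ℝ} (hy : y ∈ Set.Icc (0 : ℝ) 1) :
    1 / (1 + y) ∈ Set.Icc (1 / 2 : ℝ) 1 := by
  obtain ⟨h0, h1⟩ := hy
  constructor
  · rw [div_le_div_iff₀ (by norm_num) (by linarith)]; linarith
  · rw [div_le_one (by linarith)]; linarith

theorem inv_two_add_inv_mem {y : ℝ} (hy : y ∈ Set.Icc (0 : ℝ) 1) :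
    y / (1 + 2 * y) ∈ Set.Icc (0 : ℝ) (1 / 3) := by
  obtain ⟨h0, h1⟩ := hy
  constructor
  · positivity
  · rw [div_le_div_iff₀ (by linarith) (by norm_num)]; linarith

theorem inv_three_sub_mem {y : ℝ} (hy : y ∈ Set.Ioo (0 : ℝ) 1) :
    1 / (3 - y) ∈ Set.Ioo (1 / 3 : ℝ) (1 / 2) := by
  obtain ⟨h0, h1⟩ := hy
  constructor
  · rw [div_lt_div_iff₀ (by norm_num) (by linarith)]; linarith
  · rw [div_lt_div_iff₀ (by linarith) (by norm_num)]; linarith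

theorem TailSum.mem_Icc {y : ℝ} {s : ℕ} (h : TailSum y s) : y ∈ Set.Icc (0 : ℝ) 1 := by
  induction h with
  | zero => simp
  | inv_one_add _ ih =>
    have := inv_one_add_mem ih
    exact ⟨by linarith [this.1], this.2⟩
  | inv_two_add_inv _ _ ih =>
    have := inv_two_add_inv_mem ih
    exact ⟨this.1, by linarith [this.2]⟩
  | inv_three_sub _ h0 h1 _ =>
    have := inv_three_sub_mem ⟨h0, h1⟩
    exact ⟨by linarith [this.1], by linarith [this.2]⟩

theorem TailSum.exists_rat {y : ℝ} {s : ℕ} (h : TailSum y s) : ∃ q : ℚ, (q : ℝ) = y := by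
  induction h with
  | zero => exact ⟨0, by simp⟩
  | inv_one_add _ ih => obtain ⟨q, rfl⟩ := ih; exact ⟨1 / (1 + q), by push_cast; rfl⟩
  | inv_two_add_inv _ _ ih => obtain ⟨q, rfl⟩ := ih; exact ⟨q / (1 + 2 * q), by push_cast; rfl⟩
  | inv_three_sub _ _ _ ih => obtain ⟨q, rfl⟩ := ih; exact ⟨1 / (3 - q), by push_cast; rfl⟩

theorem TailSum.one : TailSum 1 1 := by
  simpa using TailSum.inv_one_add TailSum.zero

/-- The map `y ↦ y / (1 + 2y)` adds 2 to `1 / y`. Iterating it reduces every odd quotient to the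
base quotients 1 and 3. -/
theorem TailSum.inv_shift {t : ℝ} {s : ℕ} (ht : 0 < t) (h : TailSum (1 / t) s) (k : ℕ) :
    TailSum (1 / (t + 2 * k)) (s + 2 * k) := by
  induction k with
  | zero => simpa using h
  | succ k ih =>
    have hk : 0 < t + 2 * k := by positivity
    have := TailSum.inv_two_add_inv ih (by positivity)
    convert this using 1
    · push_cast
      field_simp
      ring
    · ring

theorem TailSum.inv_odd_add {y : ℝ} {s a : ℕ} (h : TailSum y s) (ha : Odd a) :
    TailSum (1 / (a + y)) (s + a) := by
  obtain ⟨k, rfl⟩ := ha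
  have := TailSum.inv_shift (by linarith [h.mem_Icc.1]) (TailSum.inv_one_add h) k
  convert this using 1
  · push_cast; ring
  · ring

theorem TailSum.inv_odd_sub {y : ℝ} {s a : ℕ} (h : TailSum y s) (h0 : 0 < y) (h1 : y < 1)
    (ha : Odd a) (ha3 : 3 ≤ a) : TailSum (1 / (a - y)) (s + a) := by
  obtain ⟨k, rfl⟩ := ha
  obtain ⟨k, rfl⟩ : ∃ j, k = j + 1 := ⟨k - 1, by omega⟩
  have := TailSum.inv_shift (by linarith) (TailSum.inv_three_sub h h0 h1) k
  convert this using 1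
  · push_cast; ring
  · ring

/-- The tails whose sum of partial quotients is at most `m`. -/
def tailSet (m : ℕ) : Set ℝ := {y | ∃ s ≤ m, TailSum y s}

theorem zero_mem_tailSet (m : ℕ) : (0 : ℝ) ∈ tailSet m := ⟨0, Nat.zero_le m, TailSum.zero⟩

theorem one_mem_tailSet {m : ℕ} (hm : 1 ≤ m) : (1 : ℝ) ∈ tailSet m := ⟨1, hm, TailSum.one⟩

theorem tailSet_subset_Icc (m : ℕ) : tailSet m ⊆ Set.Icc 0 1 := fun _ ⟨_, _, h⟩ => h.mem_Icc

theorem finite_tailSet (m : ℕ) : (tailSet m).Finite := by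
  induction m with
  | zero =>
    refine (Set.finite_singleton (0 : ℝ)).subset ?_
    rintro y ⟨s, hs, h⟩
    cases h <;> first | rfl | omega
  | succ m ih =>
    refine (((Set.finite_singleton (0 : ℝ)).union (ih.image fun y => 1 / (1 + y))).union
      ((ih.image fun y => y / (1 + 2 * y)).union (ih.image fun y => 1 / (3 - y)))).subset ?_
    rintro y ⟨s, hs, h⟩
    cases h with
    | zero => exact Or.inl (Or.inl rfl)
    | inv_one_add h => exact Or.inl (Or.inr ⟨_, ⟨_, by omega, h⟩, rfl⟩)
    | inv_two_add_inv h _ => exact Or.inr (Or.inl ⟨_, ⟨_, by omega, h⟩, rfl⟩)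
    | inv_three_sub h _ _ => exact Or.inr (Or.inr ⟨_, ⟨_, by omega, h⟩, rfl⟩)

theorem inv_one_add_mem_tailSet {m : ℕ} {y : ℝ} (h : y ∈ tailSet m) :
    1 / (1 + y) ∈ tailSet (m + 1) := by
  obtain ⟨s, hs, h⟩ := h
  exact ⟨s + 1, by omega, h.inv_one_add⟩

theorem inv_two_add_inv_mem_tailSet {m : ℕ} {y : ℝ} (h : y ∈ tailSet m) :
    y / (1 + 2 * y) ∈ tailSet (m + 2) := by
  obtain ⟨s, hs, h⟩ := h
  by_cases hy : y = 0
  · subst hy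
    simpa using zero_mem_tailSet (m + 2)
  · exact ⟨s + 2, by omega, h.inv_two_add_inv hy⟩

theorem inv_three_sub_mem_tailSet {m : ℕ} {y : ℝ} (h : y ∈ tailSet m) (hy : y ∈ Set.Ioo (0 : ℝ) 1) :
    1 / (3 - y) ∈ tailSet (m + 3) := by
  obtain ⟨s, hs, h⟩ := h
  exact ⟨s + 3, by omega, h.inv_three_sub hy.1 hy.2⟩

theorem exists_of_half_le {m : ℕ} {z : ℝ} (hz : z ∈ tailSet (m + 1)) (h : 1 / 2 ≤ z) :
    ∃ y ∈ tailSet m, 1 / (1 + y) = z := by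
  obtain ⟨s, hs, hz⟩ := hz
  cases hz with
  | zero => norm_num at h
  | inv_one_add hy => exact ⟨_, ⟨_, by omega, hy⟩, rfl⟩
  | inv_two_add_inv hy _ => linarith [(inv_two_add_inv_mem hy.mem_Icc).2]
  | inv_three_sub hy h0 h1 => linarith [(inv_three_sub_mem ⟨h0, h1⟩).2]

theorem exists_of_le_third {m : ℕ} {z : ℝ} (hz : z ∈ tailSet (m + 2)) (h : z ≤ 1 / 3) :
    ∃ y ∈ tailSet m, y / (1 + 2 * y) = z := by
  obtain ⟨s, hs, hz⟩ := hz
  cases hz with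
  | zero => exact ⟨0, zero_mem_tailSet m, by simp⟩
  | inv_one_add hy => linarith [(inv_one_add_mem hy.mem_Icc).1]
  | inv_two_add_inv hy _ => exact ⟨_, ⟨_, by omega, hy⟩, rfl⟩
  | inv_three_sub hy h0 h1 => linarith [(inv_three_sub_mem ⟨h0, h1⟩).1]

theorem exists_of_third_lt_of_lt_half {m : ℕ} {z : ℝ} (hz : z ∈ tailSet (m + 3)) (h : 1 / 3 < z)
    (h' : z < 1 / 2) : ∃ y ∈ tailSet m, y ∈ Set.Ioo (0 : ℝ) 1 ∧ 1 / (3 - y) = z := by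
  obtain ⟨s, hs, hz⟩ := hz
  cases hz with
  | zero => norm_num at h
  | inv_one_add hy => linarith [(inv_one_add_mem hy.mem_Icc).1]
  | inv_two_add_inv hy _ => linarith [(inv_two_add_inv_mem hy.mem_Icc).2]
  | inv_three_sub hy h0 h1 => exact ⟨_, ⟨_, by omega, hy⟩, ⟨h0, h1⟩, rfl⟩

/-! ### Monotonicity of the three maps and counts of tails below a point -/

theorem inv_one_add_le_iff {y z : ℝ} (hy : 0 ≤ y) (hz : 0 ≤ z) :
    1 / (1 + y) ≤ 1 / (1 + z) ↔ z ≤ y := by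
  rw [div_le_div_iff₀ (by linarith) (by linarith)]
  constructor <;> intro h <;> linarith

theorem inv_two_add_inv_lt_iff {y z : ℝ} (hy : 0 ≤ y) (hz : 0 ≤ z) :
    y / (1 + 2 * y) < z / (1 + 2 * z) ↔ y < z := by
  rw [div_lt_div_iff₀ (by linarith) (by linarith)]
  constructor <;> intro h <;> nlinarith

theorem inv_three_sub_lt_iff {y z : ℝ} (hy : y ≤ 1) (hz : z ≤ 1) :
    1 / (3 - y) < 1 / (3 - z) ↔ y < z := by
  rw [div_lt_div_iff₀ (by linarith) (by linarith)]
  constructor <;> intro h <;> linarith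

/-- The number of elements of `tailSet m`. -/
noncomputable def tailCard (m : ℕ) : ℕ := (tailSet m).ncard

/-- The number of elements of `tailSet m` that are less than `y`. -/
noncomputable def tailCount (m : ℕ) (y : ℝ) : ℕ := (tailSet m ∩ Set.Iio y).ncard

theorem tailCount_le_tailCard (m : ℕ) (y : ℝ) : tailCount m y ≤ tailCard m :=
  Set.ncard_le_ncard Set.inter_subset_left (finite_tailSet m)

theorem tailCount_zero (m : ℕ) : tailCount m 0 = 0 := by
  have : tailSet m ∩ Set.Iio 0 = ∅ := by
    ext z
    simp only [Set.mem_inter_iff, Set.mem_Iio, Set.mem_empty_iff_false, iff_false, not_and, not_lt]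
    exact fun hz => (tailSet_subset_Icc m hz).1
  rw [tailCount, this, Set.ncard_empty]

theorem tailCount_add_ncard (m : ℕ) (y : ℝ) :
    tailCount m y + (tailSet m ∩ Set.Ici y).ncard = tailCard m := by
  rw [tailCount, ← Set.ncard_union_eq _ ((finite_tailSet m).inter_of_left _)
    ((finite_tailSet m).inter_of_left _), ← Set.inter_union_distrib_left, Set.Iio_union_Ici,
    Set.inter_univ, tailCard]
  exact Set.disjoint_left.2 fun z hz hz' => not_lt.2 (Set.mem_Ici.1 hz'.2) hz.2

theorem tailCount_add_ncard_singleton (m : ℕ) (y : ℝ) :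
    tailCount m y + (tailSet m ∩ {y}).ncard = (tailSet m ∩ Set.Iic y).ncard := by
  rw [tailCount, ← Set.ncard_union_eq _ ((finite_tailSet m).inter_of_left _)
    ((finite_tailSet m).inter_of_left _), ← Set.inter_union_distrib_left, Set.Iio_union_right]
  exact Set.disjoint_left.2 fun z hz hz' => absurd hz'.2 (ne_of_lt hz.2)

theorem tailCount_inv_two_add_inv (m : ℕ) {y : ℝ} (hy : y ∈ Set.Icc (0 : ℝ) 1) :
    tailCount (m + 2) (y / (1 + 2 * y)) = tailCount m y := by
  have : tailSet (m + 2) ∩ Set.Iio (y / (1 + 2 * y)) =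
      (fun z => z / (1 + 2 * z)) '' (tailSet m ∩ Set.Iio y) := by
    ext z
    constructor
    · rintro ⟨hz, hzy⟩
      have hzy' : z < y / (1 + 2 * y) := hzy
      obtain ⟨w, hw, rfl⟩ := exists_of_le_third hz (hzy'.le.trans (inv_two_add_inv_mem hy).2)
      exact ⟨w, ⟨hw, (inv_two_add_inv_lt_iff (tailSet_subset_Icc m hw).1 hy.1).1 hzy'⟩, rfl⟩
    · rintro ⟨w, ⟨hw, hwy⟩, rfl⟩
      exact ⟨inv_two_add_inv_mem_tailSet hw,
        (inv_two_add_inv_lt_iff (tailSet_subset_Icc m hw).1 hy.1).2 hwy⟩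
  rw [tailCount, this, Set.InjOn.ncard_image, tailCount]
  intro u hu v hv huv
  have hu0 := (tailSet_subset_Icc m hu.1).1
  have hv0 := (tailSet_subset_Icc m hv.1).1
  exact le_antisymm (not_lt.1 fun h => ((inv_two_add_inv_lt_iff hv0 hu0).2 h).ne' huv)
    (not_lt.1 fun h => ((inv_two_add_inv_lt_iff hu0 hv0).2 h).ne huv)

theorem ncard_tailSet_inter_Iic_third (m : ℕ) :
    (tailSet (m + 2) ∩ Set.Iic (1 / 3)).ncard = tailCard m := by
  have : tailSet (m + 2) ∩ Set.Iic (1 / 3) = (fun z => z / (1 + 2 * z)) '' tailSet m := by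
    ext z
    constructor
    · rintro ⟨hz, hzy⟩
      obtain ⟨w, hw, rfl⟩ := exists_of_le_third hz hzy
      exact ⟨w, hw, rfl⟩
    · rintro ⟨w, hw, rfl⟩
      exact ⟨inv_two_add_inv_mem_tailSet hw, (inv_two_add_inv_mem (tailSet_subset_Icc m hw)).2⟩
  rw [this, Set.InjOn.ncard_image, tailCard]
  intro u hu v hv huv
  have hu0 := (tailSet_subset_Icc m hu).1
  have hv0 := (tailSet_subset_Icc m hv).1
  exact le_antisymm (not_lt.1 fun h => ((inv_two_add_inv_lt_iff hv0 hu0).2 h).ne' huv)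
    (not_lt.1 fun h => ((inv_two_add_inv_lt_iff hu0 hv0).2 h).ne huv)

theorem ncard_tailSet_inter_Ici_inv_one_add (m : ℕ) {y : ℝ} (hy : y ∈ Set.Icc (0 : ℝ) 1) :
    (tailSet (m + 1) ∩ Set.Ici (1 / (1 + y))).ncard = (tailSet m ∩ Set.Iic y).ncard := by
  have : tailSet (m + 1) ∩ Set.Ici (1 / (1 + y)) =
      (fun z => 1 / (1 + z)) '' (tailSet m ∩ Set.Iic y) := by
    ext z
    constructor
    · rintro ⟨hz, hzy⟩
      have hzy' : 1 / (1 + y) ≤ z := hzy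
      obtain ⟨w, hw, rfl⟩ := exists_of_half_le hz ((inv_one_add_mem hy).1.trans hzy')
      exact ⟨w, ⟨hw, (inv_one_add_le_iff hy.1 (tailSet_subset_Icc m hw).1).1 hzy'⟩, rfl⟩
    · rintro ⟨w, ⟨hw, hwy⟩, rfl⟩
      exact ⟨inv_one_add_mem_tailSet hw,
        (inv_one_add_le_iff hy.1 (tailSet_subset_Icc m hw).1).2 hwy⟩
  rw [this, Set.InjOn.ncard_image]
  intro u hu v hv huv
  have hu0 := (tailSet_subset_Icc m hu.1).1
  have hv0 := (tailSet_subset_Icc m hv.1).1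
  exact le_antisymm ((inv_one_add_le_iff hv0 hu0).1 huv.ge) ((inv_one_add_le_iff hu0 hv0).1 huv.le)

/-- The tails below `1 / (3 - y)` are those up to `1/3` and the images of the tails strictly between
0 and `y`. The summand 1 on the left compensates for the tail 0, which `tailCount m y` counts
although its image `1/3` already lies in the first group. -/
theorem tailCount_inv_three_sub (m : ℕ) {y : ℝ} (hy : y ∈ Set.Ioc (0 : ℝ) 1) :
    tailCount (m + 3) (1 / (3 - y)) + 1 = tailCard (m + 1) + tailCount m y := by
  have h3 : 1 / 3 < 1 / (3 - y) := by
    rw [div_lt_div_iff₀ (by norm_num) (by linarith [hy.2])]; linarith [hy.1]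
  have h2 : 1 / (3 - y) ≤ 1 / 2 := by
    rw [div_le_div_iff₀ (by linarith [hy.2]) (by norm_num)]; linarith [hy.2]
  have hun : tailSet (m + 3) ∩ Set.Iio (1 / (3 - y)) = (tailSet (m + 3) ∩ Set.Iic (1 / 3)) ∪
      (fun z => 1 / (3 - z)) '' (tailSet m ∩ Set.Ioo 0 y) := by
    ext z
    constructor
    · rintro ⟨hz, hzy⟩
      have hzy' : z < 1 / (3 - y) := hzy
      rcases le_or_gt z (1 / 3) with h | h
      · exact Or.inl ⟨hz, h⟩
      · obtain ⟨w, hw, hw01, rfl⟩ := exists_of_third_lt_of_lt_half hz h (hzy'.trans_le h2)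
        exact Or.inr ⟨w, ⟨hw, hw01.1, (inv_three_sub_lt_iff hw01.2.le hy.2).1 hzy'⟩, rfl⟩
    · rintro (⟨hz, hz3⟩ | ⟨w, ⟨hw, hw0, hwy⟩, rfl⟩)
      · exact ⟨hz, lt_of_le_of_lt hz3 h3⟩
      · have hw1 : w < 1 := hwy.trans_le hy.2
        exact ⟨inv_three_sub_mem_tailSet hw ⟨hw0, hw1⟩, (inv_three_sub_lt_iff hw1.le hy.2).2 hwy⟩
  have hins : tailSet m ∩ Set.Iio y = insert 0 (tailSet m ∩ Set.Ioo 0 y) := by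
    ext z
    constructor
    · rintro ⟨hz, hzy⟩
      rcases (tailSet_subset_Icc m hz).1.eq_or_lt with h | h
      · exact Or.inl h.symm
      · exact Or.inr ⟨hz, h, hzy⟩
    · rintro (rfl | ⟨hz, -, hzy⟩)
      · exact ⟨zero_mem_tailSet m, hy.1⟩
      · exact ⟨hz, hzy⟩
  have hfin : (tailSet m ∩ Set.Ioo 0 y).Finite := (finite_tailSet m).inter_of_left _
  rw [tailCount, tailCount, hun, hins, Set.ncard_insert_of_notMem (by simp) hfin,
    Set.ncard_union_eq _ ((finite_tailSet _).inter_of_left _) (hfin.image _),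
    ncard_tailSet_inter_Iic_third, Set.InjOn.ncard_image]
  · ring
  · intro u hu v hv huv
    have hu1 : u ≤ 1 := (tailSet_subset_Icc m hu.1).2
    have hv1 : v ≤ 1 := (tailSet_subset_Icc m hv.1).2
    exact le_antisymm (not_lt.1 fun h => ((inv_three_sub_lt_iff hv1 hu1).2 h).ne' huv)
      (not_lt.1 fun h => ((inv_three_sub_lt_iff hu1 hv1).2 h).ne huv)
  · refine Set.disjoint_left.2 ?_
    rintro z ⟨-, hz⟩ ⟨w, ⟨hw, hw0, hwy⟩, rfl⟩
    exact absurd hz (not_le.2 (inv_three_sub_mem ⟨hw0, hwy.trans_le hy.2⟩).1)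

/-- Split `[0, 1]` at `1/2`, the image of 1 under both `1 / (3 - y)` and `1 / (1 + y)`. The deficit
2 comes from the tails 0 and 1, which the middle map omits; `1 ≤ m` ensures that 1 is present. -/
theorem tailCard_recurrence {m : ℕ} (hm : 1 ≤ m) :
    tailCard (m + 3) + 2 = tailCard (m + 2) + tailCard (m + 1) + tailCard m := by
  have h1 := tailCount_inv_three_sub m (y := 1) (by simp)
  have h2 := tailCount_add_ncard (m + 3) (1 / (1 + 1))
  rw [ncard_tailSet_inter_Ici_inv_one_add (m + 2) (y := 1) (by simp)] at h2
  have h3 : tailSet (m + 2) ∩ Set.Iic 1 = tailSet (m + 2) :=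
    Set.inter_eq_left.2 fun z hz => (tailSet_subset_Icc _ hz).2
  have h4 := tailCount_add_ncard m 1
  have h5 : tailSet m ∩ Set.Ici 1 = {1} := by
    ext z
    constructor
    · rintro ⟨hz, hz1⟩
      exact le_antisymm (tailSet_subset_Icc _ hz).2 hz1
    · rintro rfl
      exact ⟨one_mem_tailSet hm, Set.self_mem_Ici⟩
  rw [h5, Set.ncard_singleton] at h4
  rw [h3, ← tailCard] at h2
  norm_num at h1 h2
  omega

theorem two_le_tailCard {m : ℕ} (hm : 1 ≤ m) : 2 ≤ tailCard m := by
  have h : ({0, 1} : Set ℝ) ⊆ tailSet m := by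
    rintro z (rfl | rfl)
    exacts [zero_mem_tailSet m, one_mem_tailSet hm]
  have := Set.ncard_le_ncard h (finite_tailSet m)
  rwa [Set.ncard_pair zero_ne_one] at this

theorem tailCard_pos (m : ℕ) : 0 < tailCard m :=
  (Set.ncard_pos (finite_tailSet m)).2 ⟨0, zero_mem_tailSet m⟩

/-- A crude linear bound suffices, since only divergence is needed to make bounded counting errors
negligible. -/
theorem le_tailCard (m : ℕ) : m ≤ tailCard (m + 3) := by
  induction m with
  | zero => simp
  | succ m ih =>
    have := tailCard_recurrence (m := m + 1) (by omega)
    have h1 := two_le_tailCard (m := m + 1) (by omega)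
    have h2 := two_le_tailCard (m := m + 2) (by omega)
    have h3 : m + 1 + 2 = m + 3 := by ring
    rw [h3] at this
    have h4 : m + 1 + 3 = m + 4 := by ring
    have h5 : m + 1 + 1 = m + 2 := by ring
    rw [h4, h5] at this
    rw [h4]
    omega

theorem tendsto_tailCard_atTop : Tendsto (fun m => (tailCard m : ℝ)) atTop atTop := by
  refine tendsto_natCast_atTop_atTop.comp ?_
  rw [← tendsto_add_atTop_iff_nat 3]
  exact tendsto_atTop_mono le_tailCard tendsto_id

/-! ### The growth rate of tribonacci sequences -/

/-- A solution of the tribonacci recurrence stays within bounded distance of a geometric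
progression from one step to the next. -/
theorem exists_abs_succ_sub_le {lam : ℝ} (hlam : lam ^ 3 - lam ^ 2 - lam - 1 = 0) {u : ℕ → ℝ}
    (hu : ∀ m, u (m + 3) = u (m + 2) + u (m + 1) + u m) :
    ∃ B, ∀ m, |u (m + 1) - lam * u m| ≤ B := by
  have h1 := one_lt_of_tribonacci hlam
  have h2 : lam < 2 := by
    by_contra hn
    push Not at hn
    nlinarith [mul_nonneg (sub_nonneg.2 hn) (sq_nonneg lam)]
  -- Subtracting `lam * u m` removes the dominant root. The remainder satisfies the second-order
  -- recurrence of the cubic divided by `X - lam`, whose constant term is `lam⁻¹`.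
  set e : ℕ → ℝ := fun m => u (m + 1) - lam * u m with he
  -- A quadratic form that this second-order recurrence multiplies by `lam⁻¹` at each step; it
  -- avoids the complex roots.
  set Q : ℕ → ℝ := fun m => lam * e (m + 1) ^ 2 + lam * (lam - 1) * e (m + 1) * e m + e m ^ 2
    with hQ
  have hrec : ∀ m, lam * e (m + 2) = -(lam * (lam - 1)) * e (m + 1) - e m := by
    intro m
    simp only [he]
    rw [show m + 2 + 1 = m + 3 from rfl, hu m, show m + 1 + 1 = m + 2 from rfl]
    linear_combination (-u (m + 1)) * hlam
  have hstep : ∀ m, lam * Q (m + 1) = Q m := by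
    intro m
    have h := hrec m
    simp only [hQ]
    rw [show m + 1 + 1 = m + 2 from rfl]
    linear_combination (lam * e (m + 2) - e m) * h
  have hpos : ∀ m, e m ^ 2 ≤ 4 * Q m := by
    intro m
    -- By the cubic the left side equals `2 - (lam - 1) ^ 2`. Completing the square in `4 * Q m`
    -- then leaves at least `2 * e m ^ 2`.
    have hc : lam * (lam - 1) ^ 2 ≤ 2 := by nlinarith
    have : 0 ≤ lam * (2 * e (m + 1) + (lam - 1) * e m) ^ 2 := by positivity
    simp only [hQ]
    nlinarith [mul_nonneg (sub_nonneg.2 hc) (sq_nonneg (e m)), sq_nonneg (e m)]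
  have hle : ∀ m, Q m ≤ Q 0 := by
    intro m
    induction m with
    | zero => exact le_rfl
    | succ m ih =>
      have h3 := hstep m
      have h4 : 0 ≤ Q (m + 1) := by nlinarith [hpos (m + 1), sq_nonneg (e (m + 1))]
      nlinarith
  refine ⟨Real.sqrt (4 * Q 0), fun m => Real.abs_le_sqrt ?_⟩
  linarith [hpos m, hle m]

theorem tendsto_tailCard_div_succ {lam : ℝ} (hlam : lam ^ 3 - lam ^ 2 - lam - 1 = 0) :
    Tendsto (fun m => (tailCard m : ℝ) / tailCard (m + 1)) atTop (𝓝 lam⁻¹) := by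
  have h1 := one_lt_of_tribonacci hlam
  -- Subtracting 1 makes the recurrence homogeneous, and the index shift is needed because it holds
  -- only from `m = 1`.
  obtain ⟨B, hB⟩ := exists_abs_succ_sub_le hlam (u := fun m => (tailCard (m + 1) : ℝ) - 1)
    (fun m => by
      have h := tailCard_recurrence (m := m + 1) (by omega)
      have h' : (tailCard (m + 3 + 1) : ℝ) + 2 =
        tailCard (m + 2 + 1) + tailCard (m + 1 + 1) + tailCard (m + 1) := by exact_mod_cast h
      linarith)
  have h0 : Tendsto (fun m => ((tailCard (m + 1) : ℝ) - lam * tailCard m) / tailCard (m + 1))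
      atTop (𝓝 0) := by
    rw [← tendsto_add_atTop_iff_nat 1]
    refine squeeze_zero_norm (a := fun m => (B + lam) / tailCard (m + 1 + 1)) ?_ ?_
    · intro m
      rw [Real.norm_eq_abs, abs_div, Nat.abs_cast]
      gcongr
      have := hB m
      rw [abs_le] at this ⊢
      constructor <;> linarith [this.1, this.2]
    · exact Tendsto.div_atTop tendsto_const_nhds
        (tendsto_tailCard_atTop.comp (tendsto_add_atTop_nat 2))
  have h2 : Tendsto (fun m => lam⁻¹ *
      (1 - ((tailCard (m + 1) : ℝ) - lam * tailCard m) / tailCard (m + 1))) atTop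
      (𝓝 (lam⁻¹ * (1 - 0))) := (h0.const_sub 1).const_mul _
  rw [sub_zero, mul_one] at h2
  refine h2.congr fun m => ?_
  have := tailCard_pos (m + 1)
  have h3 : (tailCard (m + 1) : ℝ) ≠ 0 := by positivity
  field_simp
  ring

theorem tendsto_tailCard_div_add {lam : ℝ} (hlam : lam ^ 3 - lam ^ 2 - lam - 1 = 0) (p : ℕ) :
    Tendsto (fun m => (tailCard m : ℝ) / tailCard (m + p)) atTop (𝓝 (lam⁻¹ ^ p)) := by
  induction p with
  | zero =>
    refine tendsto_const_nhds.congr fun m => ?_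
    have := tailCard_pos m
    rw [add_zero, pow_zero, div_self (by positivity)]
  | succ p ih =>
    have h := ih.mul ((tendsto_tailCard_div_succ hlam).comp (tendsto_add_atTop_nat p))
    rw [← pow_succ] at h
    refine h.congr fun m => ?_
    have := tailCard_pos (m + p)
    simp only [Function.comp]
    rw [div_mul_div_cancel₀ (by positivity)]
    rfl

/-! ### Approximate distribution of tails -/

/-- Asymptotically the proportion of tails less than `y` differs from `d` by at most `δ`. -/
def NearDistribution (y d δ : ℝ) : Prop :=
  ∃ e : ℕ → ℝ, Tendsto e atTop (𝓝 δ) ∧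
    ∀ᶠ m in atTop, |(tailCount m y : ℝ) / tailCard m - d| ≤ e m

theorem nearDistribution_zero : NearDistribution 0 0 0 :=
  ⟨fun _ => 0, tendsto_const_nhds, by simp [tailCount_zero]⟩

theorem nearDistribution_one (y : ℝ) : NearDistribution y 0 1 := by
  refine ⟨fun _ => 1, tendsto_const_nhds, Eventually.of_forall fun m => ?_⟩
  have := tailCard_pos m
  rw [sub_zero, abs_of_nonneg (by positivity), div_le_one (by positivity)]
  exact_mod_cast tailCount_le_tailCard m y

/-- If, up to a bounded error, the tails less than `z` are counted by `b m` plus or minus the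
number of tails less than `y` at an earlier level, approximations transfer from `y` to `z`. -/
theorem NearDistribution.transfer {lam : ℝ} (hlam : lam ^ 3 - lam ^ 2 - lam - 1 = 0)
    {y z d δ α σ : ℝ} {p : ℕ} {b : ℕ → ℝ} (hσ : |σ| = 1)
    (hb : Tendsto (fun m => b m / tailCard (m + p)) atTop (𝓝 α))
    (hz : ∀ m, |(tailCount (m + p) z : ℝ) - (b m + σ * tailCount m y)| ≤ 1)
    (h : NearDistribution y d δ) :
    NearDistribution z (α + σ * lam⁻¹ ^ p * d) (lam⁻¹ ^ p * δ) := by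
  obtain ⟨e, he, hm⟩ := h
  have hN : Tendsto (fun m => (1 : ℝ) / tailCard (m + p)) atTop (𝓝 0) :=
    Tendsto.div_atTop tendsto_const_nhds
      (tendsto_tailCard_atTop.comp (tendsto_add_atTop_nat p))
  have hr := tendsto_tailCard_div_add hlam p
  have hlim : Tendsto (fun m => 1 / (tailCard (m + p) : ℝ) + |b m / tailCard (m + p) - α| +
      (tailCard m : ℝ) / tailCard (m + p) * e m +
      |(tailCard m : ℝ) / tailCard (m + p) - lam⁻¹ ^ p| * |d|) atTop (𝓝 (lam⁻¹ ^ p * δ)) := by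
    have := ((hN.add (hb.sub_const α).abs).add (hr.mul he)).add
      ((hr.sub_const (lam⁻¹ ^ p)).abs.mul_const |d|)
    simpa using this
  refine ⟨fun m => 1 / (tailCard (m - p + p) : ℝ) + |b (m - p) / tailCard (m - p + p) - α| +
      (tailCard (m - p) : ℝ) / tailCard (m - p + p) * e (m - p) +
      |(tailCard (m - p) : ℝ) / tailCard (m - p + p) - lam⁻¹ ^ p| * |d|,
      hlim.comp (tendsto_sub_atTop_nat p), ?_⟩
  have hm' := (tendsto_sub_atTop_nat p).eventually hm
  filter_upwards [hm', eventually_ge_atTop p] with n hn hnp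
  obtain ⟨m, rfl⟩ : ∃ m, n = m + p := ⟨n - p, by omega⟩
  simp only [Nat.add_sub_cancel] at hn ⊢
  have hM : (0 : ℝ) < tailCard (m + p) := by exact_mod_cast tailCard_pos (m + p)
  have hM0 : (0 : ℝ) < tailCard m := by exact_mod_cast tailCard_pos m
  -- Four errors are separated: the bounded miscount, the convergence of `b`, the inherited error
  -- for `y`, and the convergence of the ratio of cardinalities.
  have key : (tailCount (m + p) z : ℝ) / tailCard (m + p) - (α + σ * lam⁻¹ ^ p * d) =
      ((tailCount (m + p) z : ℝ) - (b m + σ * tailCount m y)) / tailCard (m + p) +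
      (b m / tailCard (m + p) - α) +
      σ * ((tailCard m : ℝ) / tailCard (m + p) * ((tailCount m y : ℝ) / tailCard m - d)) +
      σ * (((tailCard m : ℝ) / tailCard (m + p) - lam⁻¹ ^ p) * d) := by
    field_simp
    ring
  rw [key]
  refine (abs_add_le _ _).trans (add_le_add ((abs_add_le _ _).trans (add_le_add
    ((abs_add_le _ _).trans (add_le_add ?_ le_rfl)) ?_)) ?_)
  · rw [abs_div, Nat.abs_cast]
    gcongr
    exact hz m
  · rw [abs_mul, hσ, one_mul, abs_mul, abs_of_pos (div_pos hM0 hM)]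
    gcongr
  · rw [abs_mul, hσ, one_mul, abs_mul]

theorem NearDistribution.inv_two_add_inv {lam : ℝ} (hlam : lam ^ 3 - lam ^ 2 - lam - 1 = 0)
    {y d δ : ℝ} (hy : y ∈ Set.Icc (0 : ℝ) 1) (h : NearDistribution y d δ) :
    NearDistribution (y / (1 + 2 * y)) (lam⁻¹ ^ 2 * d) (lam⁻¹ ^ 2 * δ) := by
  have := h.transfer hlam (z := y / (1 + 2 * y)) (α := 0) (σ := 1) (p := 2) (b := fun _ => 0)
    (by simp) (by simp) (fun m => by rw [tailCount_inv_two_add_inv m hy]; simp)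
  simpa using this

/-- This map reverses order, so tails below the image are counted through the complement. Whether
`y` itself is a tail changes the count by at most 1. -/
theorem NearDistribution.inv_one_add {lam : ℝ} (hlam : lam ^ 3 - lam ^ 2 - lam - 1 = 0)
    {y d δ : ℝ} (hy : y ∈ Set.Icc (0 : ℝ) 1) (h : NearDistribution y d δ) :
    NearDistribution (1 / (1 + y)) (1 - lam⁻¹ * d) (lam⁻¹ * δ) := by
  have := h.transfer hlam (z := 1 / (1 + y)) (α := 1) (σ := -1) (p := 1)
    (b := fun m => tailCard (m + 1)) (by simp) ?_ (fun m => ?_)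
  · convert this using 1 <;> ring
  · refine tendsto_const_nhds.congr fun m => ?_
    have := tailCard_pos (m + 1)
    rw [div_self (by positivity)]
  · have h1 := tailCount_add_ncard (m + 1) (1 / (1 + y))
    rw [ncard_tailSet_inter_Ici_inv_one_add m hy, ← tailCount_add_ncard_singleton] at h1
    have h2 : (tailSet m ∩ {y}).ncard ≤ 1 :=
      (Set.ncard_le_ncard Set.inter_subset_right (Set.finite_singleton y)).trans
        (Set.ncard_singleton y).le
    have h1' : (tailCount (m + 1) (1 / (1 + y)) : ℝ) +
      (tailCount m y + (tailSet m ∩ {y}).ncard) = tailCard (m + 1) := by exact_mod_cast h1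
    have h2' : ((tailSet m ∩ {y}).ncard : ℝ) ≤ 1 := by exact_mod_cast h2
    have h3 : (0 : ℝ) ≤ ((tailSet m ∩ {y}).ncard : ℝ) := by positivity
    rw [abs_le]
    constructor <;> linarith

theorem NearDistribution.inv_three_sub {lam : ℝ} (hlam : lam ^ 3 - lam ^ 2 - lam - 1 = 0)
    {y d δ : ℝ} (hy : y ∈ Set.Ioc (0 : ℝ) 1) (h : NearDistribution y d δ) :
    NearDistribution (1 / (3 - y)) (lam⁻¹ ^ 2 + lam⁻¹ ^ 3 * d) (lam⁻¹ ^ 3 * δ) := by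
  have := h.transfer hlam (z := 1 / (3 - y)) (α := lam⁻¹ ^ 2) (σ := 1) (p := 3)
    (b := fun m => tailCard (m + 1)) (by simp)
    ((tendsto_tailCard_div_add hlam 2).comp (tendsto_add_atTop_nat 1)) (fun m => ?_)
  · simpa using this
  · have h1 : (tailCount (m + 3) (1 / (3 - y)) : ℝ) + 1 = tailCard (m + 1) + tailCount m y := by
      exact_mod_cast tailCount_inv_three_sub m hy
    rw [abs_le]
    constructor <;> linarith

theorem NearDistribution.inv_shift {lam : ℝ} (hlam : lam ^ 3 - lam ^ 2 - lam - 1 = 0)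
    {t d δ : ℝ} (ht : 1 ≤ t) (h : NearDistribution (1 / t) d δ) (k : ℕ) :
    NearDistribution (1 / (t + 2 * k)) (lam⁻¹ ^ (2 * k) * d) (lam⁻¹ ^ (2 * k) * δ) := by
  induction k with
  | zero => simpa using h
  | succ k ih =>
    have hk : 1 ≤ t + 2 * k := le_add_of_le_of_nonneg ht (by positivity)
    have := ih.inv_two_add_inv hlam ⟨by positivity, by rw [div_le_one (by linarith)]; exact hk⟩
    convert this using 1
    · push_cast
      field_simp
      ring
    · ring
    · ring

/-- Prepending 1 gives `1 - lam⁻¹ * d = lam⁻¹ * (lam - d)`, and every further 2 in the quotient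
contributes `lam⁻¹ ^ 2`. The factor `lam` is the source of the `-1` in `A`. -/
theorem NearDistribution.inv_odd_add {lam : ℝ} (hlam : lam ^ 3 - lam ^ 2 - lam - 1 = 0)
    {y d δ : ℝ} {a : ℕ} (hy : y ∈ Set.Icc (0 : ℝ) 1) (ha : Odd a) (h : NearDistribution y d δ) :
    NearDistribution (1 / (a + y)) (lam⁻¹ ^ a * (lam - d)) (lam⁻¹ ^ a * δ) := by
  have h0 : lam ≠ 0 := by linarith [one_lt_of_tribonacci hlam]
  obtain ⟨k, rfl⟩ := ha
  have := (h.inv_one_add hlam hy).inv_shift hlam (by linarith [hy.1]) k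
  convert this using 1
  · push_cast; ring
  · rw [pow_succ]; field_simp
  · ring

theorem NearDistribution.inv_odd_sub {lam : ℝ} (hlam : lam ^ 3 - lam ^ 2 - lam - 1 = 0)
    {y d δ : ℝ} {a : ℕ} (hy : y ∈ Set.Ioc (0 : ℝ) 1) (ha : Odd a) (ha3 : 3 ≤ a)
    (h : NearDistribution y d δ) :
    NearDistribution (1 / (a - y)) (lam⁻¹ ^ a * (lam + d)) (lam⁻¹ ^ a * δ) := by
  have h0 : lam ≠ 0 := by linarith [one_lt_of_tribonacci hlam]
  obtain ⟨k, rfl⟩ := ha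
  obtain ⟨k, rfl⟩ : ∃ j, k = j + 1 := ⟨k - 1, by omega⟩
  have := (h.inv_three_sub hlam hy).inv_shift hlam (by linarith [hy.2]) k
  convert this using 1
  · push_cast; ring
  · rw [show 2 * (k + 1) + 1 = 2 * k + 3 by ring, pow_add]; field_simp
  · ring

theorem NearDistribution.tendsto {y d : ℝ} (h : NearDistribution y d 0) :
    Tendsto (fun m => (tailCount m y : ℝ) / tailCard m) atTop (𝓝 d) := by
  obtain ⟨e, he, hm⟩ := h
  rw [tendsto_iff_norm_sub_tendsto_zero]
  exact squeeze_zero' (Eventually.of_forall fun _ => norm_nonneg _) hm he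

/-! ### One level of the fraction with either sign -/

theorem one_le_odd_add {a : ℕ} {σ : ℤ} {y : ℝ} (hσ : σ = 1 ∨ σ = -1) (ha : Odd a)
    (h2 : 2 ≤ (a : ℤ) + σ) (hy : y ∈ Set.Icc (0 : ℝ) 1) : 1 ≤ (a : ℝ) + σ * y := by
  have h1 : (1 : ℝ) ≤ a := by exact_mod_cast ha.pos
  have h2' : (2 : ℝ) ≤ a + σ := by exact_mod_cast h2
  obtain ⟨hy0, hy1⟩ := hy
  rcases hσ with rfl | rfl
  · push_cast; linarith
  · push_cast at h2' ⊢; linarith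

theorem TailSum.inv_odd_add_sign_mul {a s : ℕ} {σ : ℤ} {y : ℝ} (h : TailSum y s)
    (hσ : σ = 1 ∨ σ = -1) (ha : Odd a) (h2 : 2 ≤ (a : ℤ) + σ)
    (hy : σ = -1 → y ∈ Set.Ioo (0 : ℝ) 1) : TailSum (1 / (a + σ * y)) (s + a) := by
  rcases hσ with rfl | rfl
  · simpa using h.inv_odd_add ha
  · have := h.inv_odd_sub (hy rfl).1 (hy rfl).2 ha (by omega)
    convert this using 2
    push_cast
    ring

theorem NearDistribution.inv_odd_add_sign_mul {lam : ℝ} (hlam : lam ^ 3 - lam ^ 2 - lam - 1 = 0)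
    {y d δ : ℝ} {a : ℕ} {σ : ℤ} (hσ : σ = 1 ∨ σ = -1) (ha : Odd a) (h2 : 2 ≤ (a : ℤ) + σ)
    (hy : y ∈ Set.Ioc (0 : ℝ) 1) (h : NearDistribution y d δ) :
    NearDistribution (1 / (a + σ * y)) (lam⁻¹ ^ a * (lam - σ * d)) (lam⁻¹ ^ a * δ) := by
  rcases hσ with rfl | rfl
  · simpa using h.inv_odd_add hlam (Set.Ioc_subset_Icc_self hy) ha
  · have := h.inv_odd_sub hlam hy ha (by omega)
    convert this using 2
    · push_cast; ring
    · push_cast; ring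

/-! ### Complete tails and the value of a fraction -/

namespace OddContFrac

/-- `y j = 1 / (a_j + ε_{j+1} / (a_{j+1} + …))` is the sequence of complete tails of `c`. -/
structure IsTailSeq (c : OddContFrac) (y : ℕ → ℝ) : Prop where
  eq : ∀ j : ℕ, 1 ≤ j → (j : ℕ∞) ≤ c.len → y j = 1 / (c.a j + c.ε (j + 1) * y (j + 1))
  mem : ∀ j : ℕ, 1 ≤ j → (j : ℕ∞) ≤ c.len → y j ∈ Set.Ioc (0 : ℝ) 1
  end_zero : ∀ l : ℕ, c.len = l → y (l + 1) = 0

theorem sign_mul_self (c : OddContFrac) {j : ℕ} (hj : 1 ≤ j) (hl : (j : ℕ∞) ≤ c.len) :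
    (c.ε j : ℝ) * c.ε j = 1 := by
  rcases c.ε_sign j hj hl with h | h <;> simp [h]

theorem succ_le_len_or (c : OddContFrac) {j : ℕ} (hl : (j : ℕ∞) ≤ c.len) :
    ((j + 1 : ℕ) : ℕ∞) ≤ c.len ∨ c.len = j := by
  rcases hl.eq_or_lt with h | h
  · exact Or.inr h.symm
  · left
    push_cast
    exact Order.add_one_le_of_lt h

/-- A block carries its own leading sign; multiplying by that sign turns it into a truncated tail.
The lower bound does not depend on `k`, so limits of truncated tails stay away from 0 and can be
inverted. -/
theorem sign_mul_block_mem (c : OddContFrac) (k : ℕ) : ∀ j : ℕ, 1 ≤ j →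
    ((j + k : ℕ) : ℕ∞) ≤ c.len →
      c.ε j * c.block j (k + 1) = 1 / (c.a j + c.block (j + 1) k) ∧
      c.ε j * c.block j (k + 1) ∈ Set.Icc (1 / (c.a j + 1) : ℝ) 1 := by
  induction k with
  | zero =>
    intro j hj hl
    have h1 : (1 : ℝ) ≤ c.a j := by exact_mod_cast (c.a_odd j hj hl).pos
    have hε := c.sign_mul_self hj hl
    have h : c.ε j * c.block j (0 + 1) = 1 / (c.a j + c.block (j + 1) 0) := by
      simp only [block, add_zero]
      rw [← mul_div_assoc, hε]
    refine ⟨h, ?_⟩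
    rw [h, block, add_zero]
    constructor
    · apply one_div_le_one_div_of_le <;> linarith
    · rw [div_le_one (by linarith)]; exact h1
  | succ k ih =>
    intro j hj hl
    have hl1 : ((j + 1 : ℕ) : ℕ∞) ≤ c.len := le_trans (by norm_cast; omega) hl
    have hl0 : (j : ℕ∞) ≤ c.len := le_trans (by norm_cast; omega) hl
    obtain ⟨-, hm⟩ := ih (j + 1) (by omega) (by rwa [show j + 1 + k = j + (k + 1) by ring])
    have h : c.ε j * c.block j (k + 1 + 1) = 1 / (c.a j + c.block (j + 1) (k + 1)) := by
      rw [block, ← mul_div_assoc, c.sign_mul_self hj hl0]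
    have hb : c.block (j + 1) (k + 1) =
        c.ε (j + 1) * (c.ε (j + 1) * c.block (j + 1) (k + 1)) := by
      rw [← mul_assoc, c.sign_mul_self (by omega) hl1, one_mul]
    set z := (c.ε (j + 1) : ℝ) * c.block (j + 1) (k + 1)
    have hz0 : 0 ≤ z := le_trans (by positivity) hm.1
    have hd := one_le_odd_add (c.ε_sign (j + 1) (by omega) hl1) (c.a_odd j hj hl0)
      (c.admissible j hj hl1) ⟨hz0, hm.2⟩
    refine ⟨h, ?_⟩
    rw [h, hb]
    constructor
    · apply one_div_le_one_div_of_le (by linarith)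
      have : (c.ε (j + 1) : ℝ) * z ≤ 1 := by
        have hz1 := hm.2
        rcases c.ε_sign (j + 1) (by omega) hl1 with h | h <;> rw [h] <;> push_cast <;> linarith
      linarith
    · rw [div_le_one (by linarith)]; exact hd

theorem exists_isTailSeq_of_len_eq (c : OddContFrac) {l : ℕ} (hl : c.len = l) :
    ∃ y, c.IsTailSeq y ∧ c.convergent l = 1 - y 1 := by
  have hle : ∀ {j : ℕ}, (j : ℕ∞) ≤ c.len ↔ j ≤ l := fun {j} => by rw [hl]; norm_cast
  refine ⟨fun j => c.ε j * c.block j (l + 1 - j), ⟨?_, ?_, ?_⟩, ?_⟩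
  · intro j hj hjl
    have hjl' := hle.1 hjl
    obtain ⟨k, rfl⟩ : ∃ k, l = j + k := ⟨l - j, by omega⟩
    have h := (c.sign_mul_block_mem k j hj (hle.2 le_rfl)).1
    simp only [show j + k + 1 - j = k + 1 by omega, show j + k + 1 - (j + 1) = k by omega]
    rw [h]
    congr 2
    -- For `k = 0` the sign at index `j + 1` lies beyond the length and is arbitrary, but it
    -- multiplies an empty block.
    rcases k with _ | k
    · simp [block]
    · rw [← mul_assoc, c.sign_mul_self (by omega) (hle.2 (by omega)), one_mul]
  · intro j hj hjl
    have hjl' := hle.1 hjl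
    obtain ⟨k, rfl⟩ : ∃ k, l = j + k := ⟨l - j, by omega⟩
    have h := (c.sign_mul_block_mem k j hj (hle.2 le_rfl)).2
    simp only [show j + k + 1 - j = k + 1 by omega]
    exact ⟨lt_of_lt_of_le (by positivity) h.1, h.2⟩
  · intro l' hl'
    have : l' = l := by rw [hl] at hl'; exact_mod_cast hl'.symm
    subst this
    simp [block]
  · rcases l with _ | l
    · simp [convergent, block]
    · change 1 + c.block 1 (l + 1) = 1 - (c.ε 1 : ℝ) * c.block 1 (l + 1)
      rw [c.ε_first (by exact_mod_cast hle.2 (show 1 ≤ l + 1 by omega))]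
      push_cast
      ring

/-- Convergence passes from each level to the next: the next block is the reciprocal of the
truncated tail minus the quotient, and the limit being inverted is nonzero. -/
theorem exists_isTailSeq_of_len_eq_top (c : OddContFrac) (hl : c.len = ⊤) {x : ℝ}
    (hx : Tendsto c.convergent atTop (𝓝 x)) : ∃ y, c.IsTailSeq y ∧ x = 1 - y 1 := by
  have hle : ∀ j : ℕ, (j : ℕ∞) ≤ c.len := fun j => by rw [hl]; exact le_top
  have hmem := fun k j hj => c.sign_mul_block_mem k j hj (hle (j + k))
  have hlow : ∀ {j : ℕ} {v : ℝ}, 1 ≤ j → Tendsto (c.block j) atTop (𝓝 v) →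
      c.ε j * v ∈ Set.Icc (1 / (c.a j + 1) : ℝ) 1 := fun {j v} hj hv =>
    isClosed_Icc.mem_of_tendsto ((hv.comp (tendsto_add_atTop_nat 1)).const_mul _)
      (Eventually.of_forall fun k => (hmem k j hj).2)
  have hlim : ∀ j : ℕ, ∃ v, Tendsto (c.block (j + 1)) atTop (𝓝 v) := by
    intro j
    induction j with
    | zero =>
      refine ⟨x - 1, (hx.sub_const 1).congr fun k => ?_⟩
      simp [convergent]
    | succ j ih =>
      obtain ⟨v, hv⟩ := ih
      have hv0 : (c.ε (j + 1) : ℝ) * v ≠ 0 :=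
        (lt_of_lt_of_le (by positivity) (hlow (by omega) hv).1).ne'
      refine ⟨1 / (c.ε (j + 1) * v) - c.a (j + 1), Tendsto.congr (fun k => ?_)
        ((tendsto_const_nhds.div ((hv.comp (tendsto_add_atTop_nat 1)).const_mul _)
          hv0).sub_const _)⟩
      simp only [Pi.div_apply, Function.comp]
      rw [(hmem k (j + 1) (by omega)).1, one_div_one_div]
      ring
  choose v hv using hlim
  have hv' : ∀ j : ℕ, 1 ≤ j → Tendsto (c.block j) atTop (𝓝 (v (j - 1))) := fun j hj => by
    have := hv (j - 1)
    rwa [Nat.sub_add_cancel hj] at this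
  have hpos : ∀ j : ℕ, 1 ≤ j → (c.ε j * v (j - 1) : ℝ) ∈ Set.Ioc (0 : ℝ) 1 := fun j hj =>
    ⟨lt_of_lt_of_le (by positivity) (hlow hj (hv' j hj)).1, (hlow hj (hv' j hj)).2⟩
  refine ⟨fun j => c.ε j * v (j - 1), ⟨?_, fun j hj _ => hpos j hj, ?_⟩, ?_⟩
  · intro j hj _
    rw [← mul_assoc, c.sign_mul_self (by omega) (hle _), one_mul, Nat.add_sub_cancel]
    have h1 : Tendsto (fun k => (c.a j : ℝ) + c.block (j + 1) k) atTop (𝓝 (c.a j + v j)) :=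
      (hv j).const_add _
    have h2 : Tendsto (fun k => (c.a j : ℝ) + c.block (j + 1) k) atTop
        (𝓝 (1 / (c.ε j * v (j - 1)))) := by
      refine (tendsto_const_nhds.div (((hv' j hj).comp (tendsto_add_atTop_nat 1)).const_mul _)
        (hpos j hj).1.ne').congr fun k => ?_
      simp only [Pi.div_apply, Function.comp]
      rw [(hmem k j hj).1, one_div_one_div]
    rw [tendsto_nhds_unique h1 h2, one_div_one_div]
  · intro l hl'
    simp [hl] at hl'
  · have h0 : v 0 = x - 1 := by
      refine tendsto_nhds_unique (hv 0) ((hx.sub_const 1).congr fun k => ?_)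
      simp [convergent]
    simp only [Nat.sub_self]
    rw [h0, c.ε_first (by exact_mod_cast hle 1)]
    push_cast
    ring

theorem Represents.exists_isTailSeq {c : OddContFrac} {x : ℝ} (h : c.Represents x) :
    ∃ y, c.IsTailSeq y ∧ x = 1 - y 1 := by
  rcases eq_or_ne c.len ⊤ with hl | hl
  · exact c.exists_isTailSeq_of_len_eq_top hl (h.2 hl)
  · obtain ⟨l, hl'⟩ := ENat.ne_top_iff_exists.1 hl
    rw [← h.1 l hl'.symm]
    exact c.exists_isTailSeq_of_len_eq hl'.symm

namespace IsTailSeq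

variable {c : OddContFrac} {y : ℕ → ℝ}

theorem one_le_denominator (h : c.IsTailSeq y) {j : ℕ} (hj : 1 ≤ j) (hl : (j : ℕ∞) ≤ c.len) :
    1 ≤ (c.a j : ℝ) + c.ε (j + 1) * y (j + 1) := by
  rcases c.succ_le_len_or hl with hl1 | hl1
  · exact one_le_odd_add (c.ε_sign (j + 1) (by omega) hl1) (c.a_odd j hj hl)
      (c.admissible j hj hl1) (Set.Ioc_subset_Icc_self (h.mem (j + 1) (by omega) hl1))
  · rw [h.end_zero j hl1, mul_zero, add_zero]
    exact_mod_cast (c.a_odd j hj hl).pos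

theorem last_of_eq_one (h : c.IsTailSeq y) {j : ℕ} (hj : 1 ≤ j) (hl : (j : ℕ∞) ≤ c.len)
    (h1 : y j = 1) : c.len = j ∧ c.a j = 1 := by
  have hd := h.one_le_denominator hj hl
  have he := h.eq j hj hl
  have ha : (1 : ℝ) ≤ c.a j := by exact_mod_cast (c.a_odd j hj hl).pos
  rw [h1, eq_div_iff (by linarith), one_mul] at he
  rcases c.succ_le_len_or hl with hl1 | hl1
  · exfalso
    have hm := h.mem (j + 1) (by omega) hl1
    have hadm : (2 : ℝ) ≤ c.a j + c.ε (j + 1) := by exact_mod_cast c.admissible j hj hl1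
    rcases c.ε_sign (j + 1) (by omega) hl1 with hs | hs <;> rw [hs] at he hadm <;>
      push_cast at he hadm <;> linarith [hm.1, hm.2]
  · rw [h.end_zero j hl1, mul_zero, add_zero] at he
    exact ⟨hl1, by exact_mod_cast he⟩

/-- A tail equal to 1 must be a final quotient 1, where the normalization of the last quotient
forces the sign `+1`. This supplies the condition `y < 1` for prepending with a minus sign. -/
theorem lt_one_of_sign_eq (h : c.IsTailSeq y) {j : ℕ} (hj : 2 ≤ j) (hl : (j : ℕ∞) ≤ c.len)
    (hs : c.ε j = -1) : y j < 1 := by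
  refine lt_of_le_of_ne (h.mem j (by omega) hl).2 fun h1 => ?_
  obtain ⟨hlen, ha⟩ := h.last_of_eq_one (by omega) hl h1
  have := c.last_quotient j hlen hj ha
  omega

theorem tailSum (h : c.IsTailSeq y) {l : ℕ} (hl : c.len = l) (k : ℕ) : ∀ j : ℕ, 1 ≤ j →
    j + k = l + 1 → TailSum (y j) (∑ i ∈ Finset.Ico j (l + 1), c.a i) := by
  have hle : ∀ {j : ℕ}, (j : ℕ∞) ≤ c.len ↔ j ≤ l := fun {j} => by rw [hl]; norm_cast
  induction k with
  | zero =>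
    rintro j hj rfl
    rw [h.end_zero l hl]
    simpa using TailSum.zero
  | succ k ih =>
    intro j hj hjk
    have hjl : (j : ℕ∞) ≤ c.len := hle.2 (by omega)
    have hj1 := ih (j + 1) (by omega) (by omega)
    rw [h.eq j hj hjl, Finset.sum_eq_sum_Ico_succ_bot (by omega), add_comm (c.a j)]
    rcases c.succ_le_len_or hjl with hl1 | hl1
    · have hm := h.mem (j + 1) (by omega) hl1
      exact hj1.inv_odd_add_sign_mul (c.ε_sign (j + 1) (by omega) hl1) (c.a_odd j hj hjl)
        (c.admissible j hj hl1)
        fun hs => ⟨hm.1, h.lt_one_of_sign_eq (by omega) hl1 hs⟩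
    · rw [h.end_zero j hl1] at hj1 ⊢
      simpa using hj1.inv_odd_add (c.a_odd j hj hjl)

/-- The extreme cases are `z / (1 + z)` and `z / (3 - z)` at `z = 1`. One level need not contract
uniformly, but its error factor is a truncated tail times an exact one. Over two levels these pair
into two products of consecutive tails, each at most `1/2`. -/
theorem mul_succ_le_half {a : ℕ} {σ : ℤ} (hσ : σ = 1 ∨ σ = -1) (ha : Odd a)
    (h2 : 2 ≤ (a : ℤ) + σ) {z : ℝ} (hz : z ∈ Set.Icc (0 : ℝ) 1) :
    1 / (a + σ * z) * z ∈ Set.Icc (0 : ℝ) (1 / 2) := by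
  have hd := one_le_odd_add hσ ha h2 hz
  have h1 : (1 : ℝ) ≤ a := by exact_mod_cast ha.pos
  have h2' : (2 : ℝ) ≤ a + σ := by exact_mod_cast h2
  have hz0 := hz.1
  refine ⟨by positivity, ?_⟩
  rw [one_div_mul_eq_div, div_le_div_iff₀ (by linarith) (by norm_num)]
  rcases hσ with rfl | rfl <;> push_cast at h2' ⊢ <;> linarith [hz.2]

theorem inv_sub_inv_eq {p q : ℝ} (hp : 1 ≤ p) (hq : 1 ≤ q) :
    1 / p - 1 / q = 1 / p * (1 / q) * (q - p) := by
  field_simp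

/-- Every two levels of a continued fraction bring the convergents four times closer to the
value. -/
theorem abs_block_sub_le (h : c.IsTailSeq y) (hl : c.len = ⊤) (k : ℕ) :
    ∀ j : ℕ, 1 ≤ j →
      |c.ε j * c.block j (2 * k) - y j| ≤ (1 / 4) ^ k ∧
      |c.ε j * c.block j (2 * k + 1) - y j| ≤ (1 / 4) ^ k := by
  have hle : ∀ j : ℕ, (j : ℕ∞) ≤ c.len := fun j => by rw [hl]; exact le_top
  have hmem : ∀ j k : ℕ, 1 ≤ j → c.ε j * c.block j k ∈ Set.Icc (0 : ℝ) 1 := by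
    intro j k hj
    rcases k with _ | k
    · simp [block]
    · have := (c.sign_mul_block_mem k j hj (hle _)).2
      exact ⟨le_trans (by positivity) this.1, this.2⟩
  have hrec : ∀ j k : ℕ, 1 ≤ j → c.ε j * c.block j (k + 1) =
      1 / (c.a j + c.ε (j + 1) * (c.ε (j + 1) * c.block (j + 1) k)) := by
    intro j k hj
    rw [(c.sign_mul_block_mem k j hj (hle _)).1, ← mul_assoc,
      c.sign_mul_self (by omega) (hle _), one_mul]
  have hstep : ∀ j k : ℕ, 1 ≤ j → |c.ε j * c.block j (k + 1) - y j| =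
      (c.ε j * c.block j (k + 1)) * y j *
        |c.ε (j + 1) * c.block (j + 1) k - y (j + 1)| := by
    intro j k hj
    have hd1 := one_le_odd_add (c.ε_sign (j + 1) (by omega) (hle _)) (c.a_odd j hj (hle _))
      (c.admissible j hj (hle _)) (hmem (j + 1) k (by omega))
    have hd2 := h.one_le_denominator hj (hle j)
    rw [hrec j k hj, h.eq j hj (hle j), inv_sub_inv_eq hd1 hd2, abs_mul, abs_of_pos (by positivity)]
    congr 1
    rw [show (c.a j : ℝ) + c.ε (j + 1) * y (j + 1) -
      (c.a j + c.ε (j + 1) * (c.ε (j + 1) * c.block (j + 1) k)) =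
      -c.ε (j + 1) * (c.ε (j + 1) * c.block (j + 1) k - y (j + 1)) by ring, abs_mul]
    rcases c.ε_sign (j + 1) (by omega) (hle _) with hs | hs <;> simp [hs]
  have hhalf : ∀ j k : ℕ, 1 ≤ j → |c.ε j * c.block j (k + 2) - y j| ≤
      1 / 4 * |c.ε (j + 2) * c.block (j + 2) k - y (j + 2)| := by
    intro j k hj
    rw [hstep j (k + 1) hj, hstep (j + 1) k (by omega)]
    have h1 := mul_succ_le_half (c.ε_sign (j + 1) (by omega) (hle _)) (c.a_odd j hj (hle _))
      (c.admissible j hj (hle _)) (hmem (j + 1) (k + 1) (by omega))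
    have h2 := mul_succ_le_half (c.ε_sign (j + 1) (by omega) (hle _)) (c.a_odd j hj (hle _))
      (c.admissible j hj (hle _)) (Set.Ioc_subset_Icc_self (h.mem (j + 1) (by omega) (hle _)))
    rw [← hrec j (k + 1) hj] at h1
    rw [← h.eq j hj (hle _)] at h2
    rw [show ∀ p q r s t : ℝ, p * q * (r * s * t) = (p * r) * (q * s) * t by intros; ring]
    refine mul_le_mul_of_nonneg_right ?_ (abs_nonneg _)
    calc _ ≤ (1 / 2 : ℝ) * (1 / 2) := mul_le_mul h1.2 h2.2 h2.1 (by norm_num)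
      _ = 1 / 4 := by norm_num
  induction k with
  | zero =>
    intro j hj
    have hb : ∀ k, |c.ε j * c.block j k - y j| ≤ 1 := fun k => by
      have h1 := hmem j k hj
      have h2 := h.mem j hj (hle j)
      rw [abs_le]
      constructor <;> linarith [h1.1, h1.2, h2.1, h2.2]
    simpa only [pow_zero] using ⟨hb _, hb _⟩
  | succ k ih =>
    intro j hj
    obtain ⟨h1, h2⟩ := ih (j + 2) (by omega)
    rw [pow_succ']
    exact ⟨(hhalf j (2 * k) hj).trans (by linarith), (hhalf j (2 * k + 1) hj).trans (by linarith)⟩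

theorem block_eq (h : c.IsTailSeq y) {l : ℕ} (hl : c.len = l) (k : ℕ) : ∀ j : ℕ, 1 ≤ j →
    j + k = l + 1 → c.block j k = c.ε j * y j := by
  induction k with
  | zero =>
    rintro j hj rfl
    rw [h.end_zero l hl, block, mul_zero]
  | succ k ih =>
    intro j hj hjk
    have hjl : (j : ℕ∞) ≤ c.len := by rw [hl]; norm_cast; omega
    rw [block, ih (j + 1) (by omega) (by omega), h.eq j hj hjl, mul_one_div]

theorem represents (h : c.IsTailSeq y) : c.Represents (1 - y 1) := by
  have hfirst : 1 ≤ c.len → (c.ε 1 : ℝ) * y 1 = -y 1 := fun h1 => by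
    rw [c.ε_first h1]; push_cast; ring
  constructor
  · intro l hl
    rw [convergent, h.block_eq hl l 1 le_rfl (by ring)]
    rcases l with _ | l
    · rw [show y 1 = 0 from h.end_zero 0 hl]; ring
    · rw [hfirst (by rw [hl]; norm_cast; omega)]; ring
  · intro hl
    have h1 : 1 ≤ c.len := by rw [hl]; exact le_top
    have hlim : Tendsto (fun k => (c.ε 1 : ℝ) * c.block 1 k) atTop (𝓝 (y 1)) := by
      rw [tendsto_iff_norm_sub_tendsto_zero]
      refine squeeze_zero (fun _ => norm_nonneg _) (g := fun k => (1 / 4 : ℝ) ^ (k / 2)) ?_ ?_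
      · intro k
        have := h.abs_block_sub_le hl (k / 2) 1 le_rfl
        rcases Nat.even_or_odd k with hk | hk
        · rw [Nat.two_mul_div_two_of_even hk] at this
          exact this.1
        · rw [Nat.two_mul_div_two_add_one_of_odd hk] at this
          exact this.2
      · exact (tendsto_pow_atTop_nhds_zero_of_lt_one (by norm_num) (by norm_num)).comp
          (Nat.tendsto_div_const_atTop (by norm_num))
    refine ((hlim.const_sub 1)).congr fun k => ?_
    rw [convergent, c.ε_first h1]
    push_cast
    ring

end IsTailSeq

/-! ### Building finite fractions from their tails -/

/-- `[1; -1/a, σ/a₁, ε₂/a₂, …]` for a finite fraction `[1; -1/a₁, ε₂/a₂, …]`. -/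
def cons (c : OddContFrac) (l : ℕ) (hl : c.len = l) (a : ℕ) (σ : ℤ) (ha : Odd a)
    (hσ : σ = 1 ∨ σ = -1) (h2 : 2 ≤ (a : ℤ) + σ) (h1 : l = 1 → c.a 1 = 1 → σ = 1) :
    OddContFrac where
  len := (l + 1 : ℕ)
  ε j := if j = 1 then -1 else if j = 2 then σ else c.ε (j - 1)
  a j := if j = 1 then a else c.a (j - 1)
  ε_sign j hj hjl := by
    have hjl' : j ≤ l + 1 := by exact_mod_cast hjl
    split_ifs with h3 h4
    · exact Or.inr rfl
    · exact hσ
    · exact c.ε_sign (j - 1) (by omega) (by rw [hl]; norm_cast; omega)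
  ε_first _ := if_pos rfl
  a_odd j hj hjl := by
    have hjl' : j ≤ l + 1 := by exact_mod_cast hjl
    split_ifs with h3
    · exact ha
    · exact c.a_odd (j - 1) (by omega) (by rw [hl]; norm_cast; omega)
  admissible j hj hjl := by
    have hjl' : j + 1 ≤ l + 1 := by exact_mod_cast hjl
    rcases eq_or_ne j 1 with rfl | h3
    · simpa using h2
    · obtain ⟨i, rfl⟩ : ∃ i, j = i + 2 := ⟨j - 2, by omega⟩
      have := c.admissible (i + 1) (by omega) (by rw [hl]; norm_cast; omega)
      simpa using this
  last_quotient l' hl' hl2 hal := by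
    have hll : l + 1 = l' := by exact_mod_cast hl'
    subst hll
    rw [if_neg (by omega), Nat.add_sub_cancel] at hal
    rw [if_neg (by omega)]
    split_ifs with h3
    · obtain rfl : l = 1 := by omega
      exact h1 rfl hal
    · rw [Nat.add_sub_cancel]
      exact c.last_quotient l hl (by omega) hal

/-- Add two to the first partial quotient. -/
def addTwo (c : OddContFrac) : OddContFrac where
  len := c.len
  ε := c.ε
  a j := if j = 1 then c.a 1 + 2 else c.a j
  ε_sign := c.ε_sign
  ε_first := c.ε_first
  a_odd j hj hjl := by
    split_ifs with h3
    · subst h3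
      exact (c.a_odd 1 hj hjl).add_even even_two
    · exact c.a_odd j hj hjl
  admissible j hj hjl := by
    have := c.admissible j hj hjl
    split_ifs with h3
    · subst h3
      simp only [Nat.reduceAdd] at this ⊢
      push_cast
      omega
    · exact this
  last_quotient l hl hl2 hal := by
    rw [if_neg (by omega)] at hal
    exact c.last_quotient l hl hl2 hal

theorem IsTailSeq.cons {c : OddContFrac} {y : ℕ → ℝ} (h : c.IsTailSeq y) {l : ℕ}
    (hl : c.len = l) {a : ℕ} {σ : ℤ} (ha : Odd a) (hσ : σ = 1 ∨ σ = -1)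
    (h2 : 2 ≤ (a : ℤ) + σ) (h1 : l = 1 → c.a 1 = 1 → σ = 1) :
    (c.cons l hl a σ ha hσ h2 h1).IsTailSeq
      (fun j => if j = 1 then 1 / (a + σ * y 1) else y (j - 1)) where
  eq j hj hjl := by
    have hjl' : j ≤ l + 1 := by exact_mod_cast (show (j : ℕ∞) ≤ (l + 1 : ℕ) from hjl)
    rcases eq_or_ne j 1 with rfl | h3
    · simp [OddContFrac.cons]
    · obtain ⟨i, rfl⟩ : ∃ i, j = i + 2 := ⟨j - 2, by omega⟩
      have := h.eq (i + 1) (by omega) (by rw [hl]; norm_cast; omega)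
      simpa [OddContFrac.cons] using this
  mem j hj hjl := by
    have hjl' : j ≤ l + 1 := by exact_mod_cast (show (j : ℕ∞) ≤ (l + 1 : ℕ) from hjl)
    split_ifs with h3
    · have hy1 : y 1 ∈ Set.Icc (0 : ℝ) 1 := by
        rcases l with _ | l
        · rw [show y 1 = 0 from h.end_zero 0 hl]; simp
        · exact Set.Ioc_subset_Icc_self (h.mem 1 le_rfl (by rw [hl]; norm_cast; omega))
      have := one_le_odd_add hσ ha h2 hy1
      exact ⟨by positivity, by rw [div_le_one (by linarith)]; exact this⟩
    · exact h.mem (j - 1) (by omega) (by rw [hl]; norm_cast; omega)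
  end_zero l' hl' := by
    have hll : l + 1 = l' := by exact_mod_cast (show ((l + 1 : ℕ) : ℕ∞) = l' from hl')
    subst hll
    rw [if_neg (by omega), Nat.add_sub_cancel, h.end_zero l hl]

theorem IsTailSeq.addTwo {c : OddContFrac} {y : ℕ → ℝ} (h : c.IsTailSeq y) {l : ℕ}
    (hl : c.len = l) (hl1 : 1 ≤ l) :
    c.addTwo.IsTailSeq (fun j => if j = 1 then y 1 / (1 + 2 * y 1) else y j) := by
  have h1 : ((1 : ℕ) : ℕ∞) ≤ c.len := by rw [hl]; norm_cast
  have hy := h.mem 1 le_rfl h1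
  have hy0 := hy.1
  refine ⟨fun j hj hjl => ?_, fun j hj hjl => ?_, fun l' hl' => ?_⟩
  · rcases eq_or_ne j 1 with rfl | h3
    · have he := h.eq 1 le_rfl h1
      have hd := h.one_le_denominator le_rfl h1
      rw [if_pos rfl, if_neg (by norm_num), he]
      simp only [OddContFrac.addTwo, if_true]
      set t := (c.a 1 : ℝ) + c.ε (1 + 1) * y (1 + 1) with ht
      rw [show ((c.a 1 + 2 : ℕ) : ℝ) + c.ε (1 + 1) * y (1 + 1) = t + 2 by rw [ht]; push_cast; ring]
      field_simp
    · rw [if_neg h3, if_neg (by omega)]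
      have := h.eq j hj hjl
      simpa [OddContFrac.addTwo, h3] using this
  · split_ifs with h3
    · refine ⟨by positivity, ?_⟩
      rw [div_le_one (by linarith)]
      linarith
    · exact h.mem j hj hjl
  · have := h.end_zero l' hl'
    have hll : l = l' := by exact_mod_cast hl.symm.trans hl'
    rw [if_neg (by omega), this]

theorem quotientSum_succ (c : OddContFrac) (n : ℕ) :
    c.quotientSum (n + 1) = c.quotientSum n + c.a (n + 1) :=
  Finset.sum_Icc_succ_top (by omega) _

theorem quotientSum_cons (c : OddContFrac) (l : ℕ) (hl : c.len = l) (a : ℕ) (σ : ℤ) (ha : Odd a)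
    (hσ : σ = 1 ∨ σ = -1) (h2 : 2 ≤ (a : ℤ) + σ) (h1 : l = 1 → c.a 1 = 1 → σ = 1) (n : ℕ) :
    (c.cons l hl a σ ha hσ h2 h1).quotientSum (n + 1) = c.quotientSum n + a := by
  induction n with
  | zero => simp [quotientSum, OddContFrac.cons]
  | succ n ih =>
    rw [quotientSum_succ, ih, quotientSum_succ]
    simp [OddContFrac.cons]
    ring

theorem quotientSum_addTwo (c : OddContFrac) (n : ℕ) :
    c.addTwo.quotientSum (n + 1) = c.quotientSum (n + 1) + 2 := by
  induction n with
  | zero => simp [quotientSum, OddContFrac.addTwo]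
  | succ n ih =>
    rw [quotientSum_succ, ih, quotientSum_succ c (n + 1)]
    simp [OddContFrac.addTwo]
    ring

end OddContFrac

/-- Each constructor is realized on actual fractions: two by `cons` and the quotient increase by
`addTwo`. -/
theorem TailSum.exists_isTailSeq {y : ℝ} {s : ℕ} (h : TailSum y s) :
    ∃ (c : OddContFrac) (l : ℕ) (z : ℕ → ℝ), c.len = l ∧ c.IsTailSeq z ∧ z 1 = y ∧
      c.quotientSum l = s := by
  induction h with
  | zero =>
    have hlt : ∀ j : ℕ, 1 ≤ j → ¬ (j : ℕ∞) ≤ 0 := fun j hj h => by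
      have : j ≤ 0 := by exact_mod_cast h
      omega
    refine ⟨⟨0, fun _ => 1, fun _ => 1, fun j hj h => absurd h (hlt j hj), fun h => ?_,
      fun j hj h => absurd h (hlt j hj), fun j hj h => absurd h (hlt _ (by omega)),
      fun l h hl => ?_⟩, 0, fun _ => 0, rfl,
      ⟨fun j hj h => absurd h (hlt j hj), fun j hj h => absurd h (hlt j hj), fun _ _ => rfl⟩,
      rfl, rfl⟩
    · exact absurd h (by exact_mod_cast hlt 1 le_rfl)
    · have : 0 = l := by exact_mod_cast h
      omega
  | @inv_one_add y s _ ih =>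
    obtain ⟨c, l, z, hl, hz, rfl, rfl⟩ := ih
    have := hz.cons hl (a := 1) (σ := 1) odd_one (Or.inl rfl) (by norm_num) (fun _ _ => rfl)
    exact ⟨_, l + 1, _, rfl, this, by simp, c.quotientSum_cons ..⟩
  | @inv_two_add_inv y s _ hy ih =>
    obtain ⟨c, l, z, hl, hz, rfl, rfl⟩ := ih
    obtain ⟨l, rfl⟩ : ∃ k, l = k + 1 := by
      rcases l with _ | l
      · exact absurd (hz.end_zero 0 hl) hy
      · exact ⟨l, rfl⟩
    exact ⟨c.addTwo, l + 1, _, hl, hz.addTwo hl (by omega), by simp, c.quotientSum_addTwo l⟩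
  | @inv_three_sub y s _ h0 h1 ih =>
    obtain ⟨c, l, z, hl, hz, rfl, rfl⟩ := ih
    -- The forbidden fraction of length one with quotient 1 has tail 1, which `h1` excludes.
    have hne : l = 1 → c.a 1 = 1 → (-1 : ℤ) = 1 := by
      rintro rfl ha
      have he := hz.eq 1 le_rfl (by rw [hl])
      rw [hz.end_zero 1 hl, ha] at he
      norm_num at he
      linarith
    have := hz.cons hl (a := 3) (σ := -1) (by decide) (Or.inr rfl) (by norm_num) hne
    exact ⟨_, l + 1, _, rfl, this, by simp [sub_eq_add_neg], c.quotientSum_cons ..⟩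

theorem hasQuotientSum_iff {x : ℝ} {s : ℕ} : HasQuotientSum x s ↔ TailSum (1 - x) s := by
  constructor
  · rintro ⟨c, l, hl, hx, rfl⟩
    obtain ⟨y, hy, rfl⟩ := hx.exists_isTailSeq
    have := hy.tailSum hl l 1 le_rfl (by ring)
    rw [sub_sub_cancel]
    rwa [OddContFrac.quotientSum, ← Finset.Ico_add_one_right_eq_Icc]
  · intro h
    obtain ⟨c, l, z, hl, hz, hz1, hs⟩ := h.exists_isTailSeq
    have := hz.represents
    rw [hz1, sub_sub_cancel] at this
    exact ⟨c, l, hl, this, hs⟩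

/-! ### Infinite expansions -/

/-- The quotient is the floor of `1 / y` if that is odd, with sign `+1`, and otherwise the next
integer, with sign `-1`. A terminating remainder would make `y` terminate, so the step can be
repeated forever. -/
theorem exists_tail_of_forall_not_tailSum {y : ℝ} (hy : y ∈ Set.Icc (0 : ℝ) 1)
    (h : ∀ s, ¬ TailSum y s) :
    ∃ (a : ℕ) (σ : ℤ) (z : ℝ), Odd a ∧ (σ = 1 ∨ σ = -1) ∧ 2 ≤ (a : ℤ) + σ ∧
      y = 1 / (a + σ * z) ∧ z ∈ Set.Icc (0 : ℝ) 1 ∧ ∀ s, ¬ TailSum z s := by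
  have h0 : 0 < y := lt_of_le_of_ne hy.1 fun h' => h 0 (h' ▸ TailSum.zero)
  have h1 : 1 ≤ 1 / y := by rw [le_div_iff₀ h0]; linarith [hy.2]
  set n := ⌊1 / y⌋₊ with hn
  have hn1 : 1 ≤ n := Nat.le_floor (by exact_mod_cast h1)
  have hle : (n : ℝ) ≤ 1 / y := Nat.floor_le (by positivity)
  have hlt : 1 / y < n + 1 := Nat.lt_floor_add_one _
  rcases Nat.even_or_odd n with ho | ho
  · have hn2 : 2 ≤ n := by
      obtain ⟨k, hk⟩ := ho
      omega
    have hey : y = 1 / (((n + 1 : ℕ) : ℝ) + ((-1 : ℤ) : ℝ) * (n + 1 - 1 / y)) := by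
      rw [show ((n + 1 : ℕ) : ℝ) + ((-1 : ℤ) : ℝ) * (n + 1 - 1 / y) = 1 / y by push_cast; ring,
        one_div_one_div]
    refine ⟨n + 1, -1, n + 1 - 1 / y, ho.add_one, Or.inr rfl, by push_cast; omega, hey,
      ⟨by linarith, by linarith⟩, fun s hs => ?_⟩
    -- If `1 / y` is the even integer `n`, the remainder is 1 and may not follow a minus sign;
    -- instead `n = (n - 1) + 1` shows that `y` terminates.
    rcases hle.eq_or_lt with he | hne
    · have := TailSum.one.inv_odd_add (a := n - 1) (Nat.Even.sub_odd hn1 ho odd_one)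
      rw [Nat.cast_sub hn1, Nat.cast_one, sub_add_cancel, he, one_div_one_div] at this
      exact h _ this
    · have := hs.inv_odd_add_sign_mul (a := n + 1) (Or.inr rfl) ho.add_one (by push_cast; omega)
        fun _ => ⟨by linarith, by linarith⟩
      rw [← hey] at this
      exact h _ this
  · have hey : y = 1 / ((n : ℝ) + ((1 : ℤ) : ℝ) * (1 / y - n)) := by
      rw [show (n : ℝ) + ((1 : ℤ) : ℝ) * (1 / y - n) = 1 / y by push_cast; ring, one_div_one_div]
    refine ⟨n, 1, 1 / y - n, ho, Or.inl rfl, by omega, hey,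
      ⟨by linarith, by linarith⟩, fun s hs => ?_⟩
    have := hs.inv_odd_add_sign_mul (Or.inl rfl) ho (by omega) (by norm_num)
    rw [← hey] at this
    exact h _ this

theorem exists_represents_of_forall_not_tailSum {y : ℝ} (hy : y ∈ Set.Icc (0 : ℝ) 1)
    (h : ∀ s, ¬ TailSum y s) : ∃ c : OddContFrac, c.Represents (1 - y) := by
  choose A σ T hA hσ hadm heq hmem hnot using
    fun z : {z : ℝ // z ∈ Set.Icc (0 : ℝ) 1 ∧ ∀ s, ¬ TailSum z s} =>
      exists_tail_of_forall_not_tailSum z.2.1 z.2.2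
  let F : {z : ℝ // z ∈ Set.Icc (0 : ℝ) 1 ∧ ∀ s, ¬ TailSum z s} →
    {z : ℝ // z ∈ Set.Icc (0 : ℝ) 1 ∧ ∀ s, ¬ TailSum z s} := fun z => ⟨T z, hmem z, hnot z⟩
  let Y : ℕ → {z : ℝ // z ∈ Set.Icc (0 : ℝ) 1 ∧ ∀ s, ¬ TailSum z s} := fun j =>
    F^[j - 1] ⟨y, hy, h⟩
  have hY : ∀ j, 1 ≤ j → Y (j + 1) = F (Y j) := fun j hj => by
    obtain ⟨i, rfl⟩ : ∃ i, j = i + 1 := ⟨j - 1, by omega⟩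
    exact Function.iterate_succ_apply' F i _
  let c : OddContFrac :=
    { len := ⊤
      ε := fun j => if j = 1 then -1 else σ (Y (j - 1))
      a := fun j => A (Y j)
      ε_sign := fun j _ _ => by
        split_ifs
        exacts [Or.inr rfl, hσ _]
      ε_first := fun _ => if_pos rfl
      a_odd := fun j _ _ => hA _
      admissible := fun j hj _ => by
        rw [if_neg (by omega), Nat.add_sub_cancel]
        exact hadm _
      last_quotient := fun l hl => by simp at hl }
  have hc : c.IsTailSeq fun j => (Y j : ℝ) := by
    refine ⟨fun j hj _ => ?_, fun j _ _ => ⟨?_, (Y j).2.1.2⟩, fun l hl => ?_⟩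
    · have hε : c.ε (j + 1) = σ (Y j) := by
        simp only [c]
        rw [if_neg (by omega), Nat.add_sub_cancel]
      rw [hε, hY j hj]
      exact heq (Y j)
    · exact lt_of_le_of_ne (Y j).2.1.1 fun h' => (Y j).2.2 0 (h' ▸ TailSum.zero)
    · simp [c] at hl
  exact ⟨c, hc.represents⟩

theorem exists_represents {x : ℝ} (hx : x ∈ Set.Icc (0 : ℝ) 1) :
    ∃ c : OddContFrac, c.Represents x := by
  by_cases h : ∃ s, TailSum (1 - x) s
  · obtain ⟨s, hs⟩ := h
    obtain ⟨c, l, -, hc, -⟩ := hasQuotientSum_iff.2 hs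
    exact ⟨c, hc⟩
  · push Not at h
    have := exists_represents_of_forall_not_tailSum ⟨by linarith [hx.2], by linarith [hx.1]⟩ h
    rwa [sub_sub_cancel] at this

/-! ### Rational values have finite length -/

namespace OddContFrac

/-- The tails of an infinite fraction are irrational, because their denominators would decrease. -/
theorem IsTailSeq.ne_div {c : OddContFrac} {y : ℕ → ℝ} (h : c.IsTailSeq y) (hl : c.len = ⊤)
    (q : ℕ) : ∀ (j p : ℕ), 1 ≤ j → y j ≠ p / q := by
  have hle : ∀ j : ℕ, (j : ℕ∞) ≤ c.len := fun j => by rw [hl]; exact le_top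
  have hlt : ∀ j, 1 ≤ j → y j < 1 := fun j hj =>
    lt_of_le_of_ne (h.mem j hj (hle j)).2 fun h1 => by
      have := (h.last_of_eq_one hj (hle j) h1).1
      simp [hl] at this
  induction q using Nat.strong_induction_on with
  | _ q ih =>
    intro j p hj hy
    have hy0 := (h.mem j hj (hle j)).1
    have hy1 := hlt j hj
    have hq : 0 < q := Nat.pos_of_ne_zero fun h0 => by simp [hy, h0] at hy0
    have hq' : (0 : ℝ) < q := by exact_mod_cast hq
    have hpq : p < q := by
      rw [hy, div_lt_one hq'] at hy1
      exact_mod_cast hy1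
    have hp : 0 < p := Nat.pos_of_ne_zero fun h0 => by simp [hy, h0] at hy0
    have hp' : (0 : ℝ) < p := by exact_mod_cast hp
    have he := h.eq j hj (hle j)
    have hd := h.one_le_denominator hj (hle j)
    have hz0 := (h.mem (j + 1) (by omega) (hle _)).1
    have hz : y (j + 1) = ((c.ε (j + 1) * ((q : ℤ) - c.a j * p) : ℤ) : ℝ) / p := by
      have h2 : (c.ε (j + 1) : ℝ) * y (j + 1) = q / p - c.a j := by
        rw [hy, eq_div_iff (by linarith)] at he
        field_simp at he ⊢
        linarith
      calc y (j + 1) = c.ε (j + 1) * (c.ε (j + 1) * y (j + 1)) := by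
            rw [← mul_assoc, c.sign_mul_self (by omega) (hle _), one_mul]
        _ = _ := by
            rw [h2]
            push_cast
            field_simp
    have hr : 0 ≤ c.ε (j + 1) * ((q : ℤ) - c.a j * p) := by
      rw [hz] at hz0
      have := (div_pos_iff_of_pos_right hp').1 hz0
      exact_mod_cast this.le
    obtain ⟨r, hr⟩ := Int.eq_ofNat_of_zero_le hr
    rw [hr, Int.cast_natCast] at hz
    exact ih p hpq (j + 1) r (by omega) hz

theorem Represents.exists_len_eq {c : OddContFrac} {x : ℝ} (h : c.Represents x)
    (hx : x ∈ Set.range ((↑) : ℚ → ℝ)) : ∃ l : ℕ, c.len = l := by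
  obtain ⟨y, hy, rfl⟩ := h.exists_isTailSeq
  by_contra hn
  have hl : c.len = ⊤ := by
    by_contra hne
    obtain ⟨l, hl⟩ := ENat.ne_top_iff_exists.1 hne
    exact hn ⟨l, hl.symm⟩
  obtain ⟨r, hr⟩ := hx
  have hy0 := (hy.mem 1 le_rfl (by rw [hl]; exact le_top)).1
  have hyr : y 1 = ((1 - r : ℚ) : ℝ) := by push_cast; linarith
  have hnum : 0 ≤ (1 - r : ℚ).num := by
    rw [Rat.num_nonneg]
    rw [hyr] at hy0
    exact_mod_cast hy0.le
  obtain ⟨p, hp⟩ := Int.eq_ofNat_of_zero_le hnum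
  refine hy.ne_div hl (1 - r : ℚ).den 1 p le_rfl ?_
  rw [hyr, Rat.cast_def, hp, Int.cast_natCast]

end OddContFrac

/-! ### Passage to the limit and the series -/

theorem NearDistribution.tendsto_of_forall {y d : ℝ} {D δ : ℕ → ℝ}
    (h : ∀ k, NearDistribution y (D k) (δ k)) (hD : Tendsto D atTop (𝓝 d))
    (hδ : Tendsto δ atTop (𝓝 0)) :
    Tendsto (fun m => (tailCount m y : ℝ) / tailCard m) atTop (𝓝 d) := by
  rw [Metric.tendsto_atTop']
  intro η hη
  obtain ⟨k, hk, hk'⟩ := ((hδ.eventually (gt_mem_nhds (half_pos hη))).and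
    (hD.eventually (Metric.ball_mem_nhds d (half_pos hη)))).exists
  obtain ⟨e, he, hm⟩ := h k
  obtain ⟨N, hN⟩ := eventually_atTop.1 (hm.and (he.eventually (gt_mem_nhds hk)))
  refine ⟨N, fun n hn => ?_⟩
  obtain ⟨h1, h2⟩ := hN n hn.le
  calc dist _ d ≤ dist _ (D k) + dist (D k) d := dist_triangle _ _ _
    _ < η / 2 + η / 2 := add_lt_add (lt_of_le_of_lt h1 h2) hk'
    _ = η := add_halves η

namespace OddContFrac

theorem E_succ (c : OddContFrac) (n : ℕ) : c.E (n + 1) = c.E n * -c.ε (n + 1) :=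
  Finset.prod_Icc_succ_top (by omega) _

theorem zpow_A (c : OddContFrac) {lam : ℝ} (h : lam ≠ 0) (i : ℕ) :
    (c.E i : ℝ) / lam ^ c.A i = c.E i * lam * lam⁻¹ ^ c.quotientSum i := by
  rw [A, zpow_sub₀ h, zpow_natCast, zpow_one, inv_pow]
  field_simp

theorem abs_E (c : OddContFrac) {i : ℕ} (hi : (i : ℕ∞) ≤ c.len) : |(c.E i : ℝ)| = 1 := by
  induction i with
  | zero => simp [E]
  | succ i ih =>
    rw [E_succ, Int.cast_mul, abs_mul, ih (le_trans (by norm_cast; omega) hi)]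
    rcases c.ε_sign (i + 1) (by omega) hi with h | h <;> simp [h]

theorem le_quotientSum (c : OddContFrac) {i : ℕ} (hi : (i : ℕ∞) ≤ c.len) :
    i ≤ c.quotientSum i := by
  induction i with
  | zero => exact Nat.zero_le _
  | succ i ih =>
    have h1 := ih (le_trans (by norm_cast; omega) hi)
    have h2 := (c.a_odd (i + 1) (by omega) hi).pos
    rw [quotientSum_succ]
    omega

theorem term_of_le (c : OddContFrac) (lam : ℝ) {i : ℕ} (h1 : 1 ≤ i) (h : (i : ℕ∞) ≤ c.len) :
    c.term lam i = (c.E i : ℝ) / lam ^ c.A i :=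
  if_pos ⟨h1, h⟩

theorem summable_term (c : OddContFrac) {lam : ℝ} (h : 1 < lam) : Summable (c.term lam) := by
  have h0 : 0 < lam := by linarith
  refine Summable.of_norm_bounded (g := fun i => lam * lam⁻¹ ^ i)
    ((summable_geometric_of_lt_one (by positivity) (inv_lt_one_of_one_lt₀ h)).mul_left lam)
    fun i => ?_
  by_cases hi : 1 ≤ i ∧ (i : ℕ∞) ≤ c.len
  · rw [c.term_of_le lam hi.1 hi.2, zpow_A c h0.ne', Real.norm_eq_abs, abs_mul, abs_mul,
      c.abs_E hi.2, one_mul, abs_of_pos h0, abs_of_pos (by positivity)]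
    exact mul_le_mul_of_nonneg_left (pow_le_pow_of_le_one (by positivity)
      (inv_le_one_of_one_le₀ h.le) (c.le_quotientSum hi.2)) h0.le
  · rw [term, if_neg hi, norm_zero]
    positivity

theorem tsum_term_of_len_eq (c : OddContFrac) (lam : ℝ) {l : ℕ} (hl : c.len = l) :
    ∑' i, c.term lam i = ∑ i ∈ Finset.Icc 1 l, (c.E i : ℝ) / lam ^ c.A i := by
  have hle : ∀ {j : ℕ}, (j : ℕ∞) ≤ c.len ↔ j ≤ l := fun {j} => by rw [hl]; norm_cast
  rw [tsum_eq_sum (s := Finset.Icc 1 l)]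
  · exact Finset.sum_congr rfl fun i hi =>
      c.term_of_le lam (Finset.mem_Icc.1 hi).1 (hle.2 (Finset.mem_Icc.1 hi).2)
  · intro i hi
    exact if_neg fun h => hi (Finset.mem_Icc.2 ⟨h.1, hle.1 h.2⟩)

theorem tendsto_sum_term (c : OddContFrac) {lam : ℝ} (h : 1 < lam) (hl : c.len = ⊤) :
    Tendsto (fun k => ∑ i ∈ Finset.Icc 1 k, (c.E i : ℝ) / lam ^ c.A i) atTop
      (𝓝 (∑' i, c.term lam i)) := by
  refine ((c.summable_term h).hasSum.tendsto_sum_nat.comp (tendsto_add_atTop_nat 1)).congr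
    fun k => ?_
  simp only [Function.comp]
  rw [Finset.sum_range_succ', show c.term lam 0 = 0 from if_neg (by simp), add_zero]
  have hk : ∀ n, ∑ i ∈ Finset.range n, c.term lam (i + 1) =
      ∑ i ∈ Finset.Icc 1 n, (c.E i : ℝ) / lam ^ c.A i := fun n => by
    induction n with
    | zero => simp
    | succ n ih =>
      rw [Finset.sum_range_succ, ih, Finset.sum_Icc_succ_top (by omega),
        c.term_of_le lam (by omega) (by rw [hl]; exact le_top)]
  exact hk k

namespace IsTailSeq

variable {c : OddContFrac} {y : ℕ → ℝ} {lam : ℝ}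

/-- The affine rule is composed over the first `k` levels: each contributes one summand of the
series, and the coefficient of `d` is the product of the slopes. -/
theorem nearDistribution_of_tail (hlam : lam ^ 3 - lam ^ 2 - lam - 1 = 0) (h : c.IsTailSeq y)
    (k : ℕ) : ∀ d δ : ℝ, ((k + 1 : ℕ) : ℕ∞) ≤ c.len → NearDistribution (y (k + 1)) d δ →
    NearDistribution (y 1) (∑ i ∈ Finset.Icc 1 k, (c.E i : ℝ) / lam ^ c.A i +
      c.E k * -c.ε (k + 1) * lam⁻¹ ^ c.quotientSum k * d) (lam⁻¹ ^ c.quotientSum k * δ) := by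
  have h0 : lam ≠ 0 := by linarith [one_lt_of_tribonacci hlam]
  induction k with
  | zero =>
    intro d δ hk hN
    have : c.ε 1 = -1 := c.ε_first (by simpa using hk)
    simpa [E, quotientSum, this] using hN
  | succ k ih =>
    intro d δ hk hN
    have hk' : ((k + 1 : ℕ) : ℕ∞) ≤ c.len := le_trans (by norm_cast; omega) hk
    have hN' := hN.inv_odd_add_sign_mul hlam (c.ε_sign (k + 1 + 1) (by omega) hk)
      (c.a_odd (k + 1) (by omega) hk') (c.admissible (k + 1) (by omega) hk)
      (h.mem (k + 1 + 1) (by omega) hk)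
    rw [← h.eq (k + 1) (by omega) hk'] at hN'
    convert ih _ _ hk' hN' using 1
    · rw [Finset.sum_Icc_succ_top (by omega), zpow_A c h0 (k + 1), E_succ, quotientSum_succ,
        pow_add]
      push_cast
      ring
    · rw [quotientSum_succ, pow_add]
      ring

theorem nearDistribution_of_len_eq (hlam : lam ^ 3 - lam ^ 2 - lam - 1 = 0) (h : c.IsTailSeq y)
    {l : ℕ} (hl : c.len = l) :
    NearDistribution (y 1) (∑ i ∈ Finset.Icc 1 l, (c.E i : ℝ) / lam ^ c.A i) 0 := by
  have h0 : lam ≠ 0 := by linarith [one_lt_of_tribonacci hlam]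
  rcases l with _ | k
  · rw [show y 1 = 0 from h.end_zero 0 hl]
    simpa using nearDistribution_zero
  · have hk : ((k + 1 : ℕ) : ℕ∞) ≤ c.len := hl.ge
    -- The last level is treated separately: its following tail is 0 and has no meaningful sign,
    -- whereas the signed rule requires a positive tail.
    have hN := nearDistribution_zero.inv_odd_add hlam (by simp) (c.a_odd (k + 1) (by omega) hk)
    have he := h.eq (k + 1) (by omega) hk
    rw [h.end_zero (k + 1) hl, mul_zero] at he
    rw [← he] at hN
    convert h.nearDistribution_of_tail hlam k _ _ hk hN using 1
    · rw [Finset.sum_Icc_succ_top (by omega), zpow_A c h0 (k + 1), E_succ, quotientSum_succ,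
        pow_add]
      push_cast
      ring
    · ring

theorem tendsto_tailCount_div (hlam : lam ^ 3 - lam ^ 2 - lam - 1 = 0) (h : c.IsTailSeq y) :
    Tendsto (fun m => (tailCount m (y 1) : ℝ) / tailCard m) atTop
      (𝓝 (∑' i, c.term lam i)) := by
  have h1 := one_lt_of_tribonacci hlam
  rcases eq_or_ne c.len ⊤ with hl | hl
  · have hle : ∀ j : ℕ, (j : ℕ∞) ≤ c.len := fun j => by rw [hl]; exact le_top
    refine NearDistribution.tendsto_of_forall (δ := fun k => lam⁻¹ ^ c.quotientSum k)
      (fun k => ?_) (c.tendsto_sum_term h1 hl) ?_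
    -- The estimate `d = 0`, `δ = 1` holds for every tail; `d = 0` leaves exactly the `k`-th partial
    -- sum.
    · simpa using h.nearDistribution_of_tail hlam k 0 1 (hle _) (nearDistribution_one _)
    · exact (tendsto_pow_atTop_nhds_zero_of_lt_one (by positivity)
        (inv_lt_one_of_one_lt₀ h1)).comp
        (tendsto_atTop_mono (fun k => c.le_quotientSum (hle k)) tendsto_id)
  · obtain ⟨l, hl'⟩ := ENat.ne_top_iff_exists.1 hl
    rw [c.tsum_term_of_len_eq lam hl'.symm]
    exact (h.nearDistribution_of_len_eq hlam hl'.symm).tendsto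

end IsTailSeq

end OddContFrac

/-! ### The distribution functions of the sets of bounded sum -/

theorem boundedSumSet_eq_image (n : ℕ) :
    boundedSumSet n = (fun y => 1 - y) '' tailSet (n + 1) := by
  ext x
  constructor
  · rintro ⟨-, -, s, hs, hsn⟩
    exact ⟨1 - x, ⟨s, hsn, hasQuotientSum_iff.1 hs⟩, by ring⟩
  · rintro ⟨y, ⟨s, hsn, hs⟩, rfl⟩
    obtain ⟨q, rfl⟩ := hs.exists_rat
    have hm := hs.mem_Icc
    exact ⟨⟨1 - q, by push_cast; rfl⟩, ⟨by linarith [hm.2], by linarith [hm.1]⟩, s,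
      hasQuotientSum_iff.2 (by rwa [sub_sub_cancel]), hsn⟩

/-- The reflection `ξ = 1 - y` turns `ξ ≤ x` into `y ≥ 1 - x`, whose complement is strict; hence
`tailCount` counts with strict inequality. -/
theorem empiricalDistribution_boundedSumSet (n : ℕ) (x : ℝ) :
    empiricalDistribution (boundedSumSet n) x =
      1 - (tailCount (n + 1) (1 - x) : ℝ) / tailCard (n + 1) := by
  have hset : {ξ | ξ ∈ boundedSumSet n ∧ ξ ≤ x} =
      (fun y => 1 - y) '' (tailSet (n + 1) ∩ Set.Ici (1 - x)) := by
    rw [boundedSumSet_eq_image]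
    ext ξ
    constructor
    · rintro ⟨⟨y, hy, rfl⟩, hx⟩
      exact ⟨y, ⟨hy, by simp only [Set.mem_Ici]; linarith⟩, rfl⟩
    · rintro ⟨y, ⟨hy, hx⟩, rfl⟩
      exact ⟨⟨y, hy, rfl⟩, by simp only [Set.mem_Ici] at hx; linarith⟩
  have hinj : Function.Injective fun y : ℝ => 1 - y := sub_right_injective
  have h1 : (tailCount (n + 1) (1 - x) : ℝ) + (tailSet (n + 1) ∩ Set.Ici (1 - x)).ncard =
      tailCard (n + 1) := by exact_mod_cast tailCount_add_ncard (n + 1) (1 - x)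
  have h2 : (0 : ℝ) < tailCard (n + 1) := by exact_mod_cast tailCard_pos (n + 1)
  rw [empiricalDistribution, hset, boundedSumSet_eq_image, Set.ncard_image_of_injective _ hinj,
    Set.ncard_image_of_injective _ hinj, ← tailCard, div_eq_iff h2.ne']
  field_simp
  linarith

theorem OddContFrac.Represents.tendsto_empiricalDistribution {lam : ℝ}
    (hlam : lam ^ 3 - lam ^ 2 - lam - 1 = 0) {c : OddContFrac} {x : ℝ} (h : c.Represents x) :
    Tendsto (fun n => empiricalDistribution (boundedSumSet n) x) atTop
      (𝓝 (1 - ∑' i, c.term lam i)) := by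
  obtain ⟨y, hy, rfl⟩ := h.exists_isTailSeq
  simp only [empiricalDistribution_boundedSumSet, sub_sub_cancel]
  exact ((hy.tendsto_tailCount_div hlam).comp (tendsto_add_atTop_nat 1)).const_sub 1

theorem theorem1 :
    (∃! lam : ℝ, lam ^ 3 - lam ^ 2 - lam - 1 = 0) ∧
    ∀ lam : ℝ, lam ^ 3 - lam ^ 2 - lam - 1 = 0 →
      ∃ F : Set.Icc (0 : ℝ) 1 → ℝ, IsLimitDistribution boundedSumSet F ∧
        ∀ x : Set.Icc (0 : ℝ) 1,
          (∃ c : OddContFrac, c.Represents (x : ℝ)) ∧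
          ∀ c : OddContFrac, c.Represents (x : ℝ) →
            Summable (c.term lam) ∧
            F x = 1 - ∑' i : ℕ, c.term lam i ∧
            ((x : ℝ) ∈ Set.range ((↑) : ℚ → ℝ) →
              ∃ l : ℕ, c.len = l ∧
                F x = 1 - ∑ i ∈ Finset.Icc 1 l, (c.E i : ℝ) / lam ^ c.A i) := by
  refine ⟨existsUnique_tribonacci, fun lam hlam => ?_⟩
  choose C hC using fun x : Set.Icc (0 : ℝ) 1 => exists_represents x.2
  -- Both sides are limits of the same sequence, so no uniqueness of expansions is needed.
  have hF : ∀ (x : Set.Icc (0 : ℝ) 1) (c : OddContFrac), c.Represents (x : ℝ) →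
      1 - ∑' i, (C x).term lam i = 1 - ∑' i, c.term lam i := fun x c hc =>
    tendsto_nhds_unique ((hC x).tendsto_empiricalDistribution hlam)
      (hc.tendsto_empiricalDistribution hlam)
  refine ⟨fun x => 1 - ∑' i, (C x).term lam i, ⟨fun n => ⟨?_, ?_, fun x hx => hx.2.1⟩,
    fun x => (hC x).tendsto_empiricalDistribution hlam⟩, fun x => ⟨⟨C x, hC x⟩, fun c hc =>
    ⟨c.summable_term (one_lt_of_tribonacci hlam), hF x c hc, fun hx => ?_⟩⟩⟩
  · rw [boundedSumSet_eq_image]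
    exact (finite_tailSet _).image _
  · rw [boundedSumSet_eq_image]
    exact ⟨_, 0, zero_mem_tailSet _, rfl⟩
  · obtain ⟨l, hl⟩ := hc.exists_len_eq hx
    exact ⟨l, hl, (hF x c hc).trans (by rw [c.tsum_term_of_len_eq lam hl])⟩
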